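/- Let $n\ge 0$, let $\mathfrak{igl}(n)$ be the complex Lie algebra with basis $L^\mu_\nu, P_\mu$ ($0\le\mu,\nu\le n-1$) and brackets $[L^\mu_\nu,L^\rho_\lambda]=-i\delta^\rho_\nu L^\mu_\lambda+i\delta^\mu_\lambda L^\rho_\nu$, $[L^\mu_\nu,P_\lambda]=i\delta^\mu_\lambda P_\nu$, $[P_\mu,P_\nu]=0$, and let $U=U(\mathfrak{igl}(n))$ be its enveloping algebra with the primitive coproduct $\Delta$ and counit $\epsilon$. Let $\mathfrak X^n=\mathbb C[x^0,\dots,x^{n-1}]$, on which $U$ acts by $P_\mu\triangleright=-i\partial_\mu$, $L^\mu_\nu\triangleright=-i x^\mu\partial_\nu$; let $\mathfrak T^n=\mathbb C[P_0,\dots,P_{n-1}]\subset U$; and let $\mathfrak W^n$ be the Weyl algebra, generated by $x^\mu,P_\mu$ with $[x^\mu,x^\nu]=[P_\mu,P_\nu]=0$, $[P_\mu,x^\nu]=-i\delta^\nu_\mu$. For a complex vector space $V$, $V[[h]]$ denotes the formal power series with coefficients in $V$. Let $\mathcal F\in (U\otimes U)[[h]]$ be a twist: $\mathcal F$ is invertible,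 $\mathcal F\equiv 1\otimes 1 \bmod h$, $\mathcal F_{12}(\Delta\otimes \mathrm{id})\mathcal F=\mathcal F_{23}(\mathrm{id}\otimes\Delta)\mathcal F$ and $(\epsilon\otimes\mathrm{id})\mathcal F=1=(\mathrm{id}\otimes\epsilon)\mathcal F$. Write $\mathcal F^{-1}=\bar{\mathrm f}^\alpha\otimes\bar{\mathrm f}_\alpha$, $f\star g=(\bar{\mathrm f}^\alpha\triangleright f)(\bar{\mathrm f}_\alpha\triangleright g)$ and $\Delta^{\mathcal F}(u)=\mathcal F\Delta(u)\mathcal F^{-1}=u_{(1)}\otimes u_{(2)}$. The smash product $\mathfrak X^n[[h]]^{\mathcal F}\rtimes U[[h]]^{\mathcal F}$ is the module $(\mathfrak X^n\otimes U)[[h]]$ with the $\mathbb C[[h]]$-bilinear, $h$-adically continuous product $(f\otimes u)\#(g\otimes w)=f\star(u_{(1)}\triangleright g)\otimes u_{(2)}w$. Let $\mathfrak W^n[[h]]^{\mathcal F}=\mathfrak X^n[[h]]^{\mathcal F}\rtimes\mathfrak T^n[[h]]^{\mathcal F}$ be its $\mathbb C[[h]]$-submodule $(\mathfrak X^n\otimes\mathfrak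 T^n)[[h]]$. It is defined as an algebra when the momenta form a Hopf subalgebra of $U[[h]]^{\mathcal F}$, i.e. when $\Delta^{\mathcal F}(\mathfrak T^n)\subset(\mathfrak T^n\otimes\mathfrak T^n)[[h]]$. Then: 1. If $\Delta^{\mathcal F}(\mathfrak T^n)\subset(\mathfrak T^n\otimes\mathfrak T^n)[[h]]$, then $\mathfrak W^n[[h]]^{\mathcal F}$ is closed under the product $\#$. 2. For every twist $\mathcal F$ there is a $\mathbb C[[h]]$-linear bijection $e:\mathfrak W^n[[h]]^{\mathcal F}\to\mathfrak W^n[[h]]$ with $e(1)=1$ and $e(a\# b)=e(a)e(b)$ for all $a,b\in\mathfrak W^n[[h]]^{\mathcal F}$ with $a\# b\in \mathfrak W^n[[h]]^{\mathcal F}$. It is the identity on momenta, $e(p)=p$ for $p\in\mathfrak T^n$, and for $f\in\mathfrak X^n$ it is $e(f)=\hat f$, the element of $\mathfrak W^n[[h]]$ obtained from $(\bar{\mathrm f}^\alpha\triangleright f)\cdot\bar{\mathrm f}_\alpha$ by the Heisenberg realization $P_\mu\mapsto P_\mu$, $L^\nu_\mu\mapsto x^\nu P_\mu$. In particular, in the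 situation of 1, $\mathfrak W^n[[h]]^{\mathcal F}$ is a unital associative algebra isomorphic over $\mathbb C[[h]]$ to $\mathfrak W^n[[h]]$. 3. The elements $\hat x^\mu, P_\mu$ again generate $\mathfrak W^n[[h]]$: the $\mathbb C[[h]]$-subalgebra that they generate is dense in the $h$-adic topology. -/

import Mathlib

open scoped TensorProduct PowerSeries

noncomputable section

namespace TwistedWeyl

/-! ### Formal power series with coefficients in a complex algebra

`A⟦X⟧` is the `h`-adic extension `A[[h]]`; the variable `X` plays the role of `h`. -/

section Hadic

variable {A B C : Type} [Ring A] [Algebra ℂ A] [Ring B] [Algebra ℂ B] [Ring C] [Algebra ℂ C]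

/-- `A[[h]]` is an algebra over `ℂ[[h]]`, also for noncommutative `A` (Cauchy product). -/
instance hadicAlgebra : Algebra ℂ⟦X⟧ A⟦X⟧ :=
  RingHom.toAlgebra' (PowerSeries.map (algebraMap ℂ A)) (by
    intro c a
    ext k
    rw [PowerSeries.coeff_mul, PowerSeries.coeff_mul, ← Finset.Nat.sum_antidiagonal_swap]
    refine Finset.sum_congr rfl fun p _ => ?_
    simpa using Algebra.commutes _ _)

theorem coeff_hadic_smul (c : ℂ⟦X⟧) (a : A⟦X⟧) (k : ℕ) :
    PowerSeries.coeff k (c • a) =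
      ∑ p ∈ Finset.HasAntidiagonal.antidiagonal k, PowerSeries.coeff p.1 c • PowerSeries.coeff p.2 a := by
  change PowerSeries.coeff k (PowerSeries.map (algebraMap ℂ A) c * a) = _
  rw [PowerSeries.coeff_mul]
  refine Finset.sum_congr rfl fun p _ => ?_
  rw [PowerSeries.coeff_map, Algebra.smul_def]

theorem coeff_complex_smul (c : ℂ) (a : A⟦X⟧) (k : ℕ) :
    PowerSeries.coeff k (c • a) = c • PowerSeries.coeff k a := rfl

/-- The constant series. -/
def hconst : A →ₗ[ℂ] A⟦X⟧ where
  toFun a := PowerSeries.C a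
  map_add' a b := map_add _ a b
  map_smul' c a := by
    ext k
    simp only [coeff_complex_smul, PowerSeries.coeff_C, RingHom.id_apply]
    split_ifs <;> simp

/-- Coefficientwise extension of a linear map `A → B` to `A[[h]] → B[[h]]`. -/
def hmap (φ : A →ₗ[ℂ] B) : A⟦X⟧ →ₗ[ℂ] B⟦X⟧ where
  toFun a := PowerSeries.mk fun k => φ (PowerSeries.coeff k a)
  map_add' a b := by ext k; simp
  map_smul' c a := by ext k; simp

/-- The `h`-adically continuous, `ℂ[[h]]`-linear extension `A[[h]] → B[[h]]` of a linear map
`φ : A → B[[h]]`, that is `∑ aᵢ hⁱ ↦ ∑ φ(aᵢ) hⁱ`. -/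
def hextend (φ : A →ₗ[ℂ] B⟦X⟧) : A⟦X⟧ →ₗ[ℂ] B⟦X⟧ where
  toFun a := PowerSeries.mk fun k =>
    ∑ p ∈ Finset.HasAntidiagonal.antidiagonal k, PowerSeries.coeff p.2 (φ (PowerSeries.coeff p.1 a))
  map_add' a b := by ext k; simp [Finset.sum_add_distrib]
  map_smul' c a := by ext k; simp [Finset.smul_sum]

/-- The `h`-adically continuous, `ℂ[[h]]`-bilinear extension `A[[h]] × B[[h]] → C[[h]]` of a
bilinear map `β : A × B → C[[h]]`. -/
def hextend₂ (β : A →ₗ[ℂ] B →ₗ[ℂ] C⟦X⟧) (a : A⟦X⟧) (b : B⟦X⟧) : C⟦X⟧ :=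
  PowerSeries.mk fun k => ∑ p ∈ Finset.HasAntidiagonal.antidiagonal k, ∑ q ∈ Finset.HasAntidiagonal.antidiagonal p.2,
    PowerSeries.coeff q.2 (β (PowerSeries.coeff p.1 a) (PowerSeries.coeff q.1 b))

theorem hmap_add (φ ψ : A →ₗ[ℂ] B) (a : A⟦X⟧) : hmap (φ + ψ) a = hmap φ a + hmap ψ a := by
  ext k; simp [hmap]

theorem hmap_smul (c : ℂ) (φ : A →ₗ[ℂ] B) (a : A⟦X⟧) : hmap (c • φ) a = c • hmap φ a := by
  ext k; simp [hmap]

theorem hextend_add (φ ψ : A →ₗ[ℂ] B⟦X⟧) (a : A⟦X⟧) :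
    hextend (φ + ψ) a = hextend φ a + hextend ψ a := by
  ext k; simp [hextend, Finset.sum_add_distrib]

theorem hextend_smul (c : ℂ) (φ : A →ₗ[ℂ] B⟦X⟧) (a : A⟦X⟧) :
    hextend (c • φ) a = c • hextend φ a := by
  ext k; simp [hextend, Finset.smul_sum]

end Hadic

/-! ### The Lie algebra `𝔦𝔤𝔩(n)` -/

/-- The inhomogeneous general linear Lie algebra `𝔤𝔩(n) ⋉ 𝔱ⁿ` over `ℂ`. -/
@[ext] structure Igl (n : ℕ) where
  /-- the homogeneous part -/
  gl : Matrix (Fin n) (Fin n) ℂ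
  /-- the translation part -/
  tr : Fin n → ℂ

namespace Igl

variable {n : ℕ}

/-- The underlying vector space is the product. -/
def toProd (n : ℕ) : Igl n ≃ Matrix (Fin n) (Fin n) ℂ × (Fin n → ℂ) where
  toFun a := (a.gl, a.tr)
  invFun a := ⟨a.1, a.2⟩
  left_inv _ := rfl
  right_inv _ := rfl

instance : AddCommGroup (Igl n) := (toProd n).addCommGroup

instance : Module ℂ (Igl n) := (toProd n).module ℂ

/-- `𝔤𝔩(n)` acts on the translations by the dual of its defining representation. -/
instance : Bracket (Igl n) (Igl n) where
  bracket a b := ⟨a.gl * b.gl - b.gl * a.gl, b.gl.transpose.mulVec a.tr - a.gl.transpose.mulVec b.tr⟩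

@[simp] theorem zero_gl : (0 : Igl n).gl = 0 := rfl
@[simp] theorem zero_tr : (0 : Igl n).tr = 0 := rfl
@[simp] theorem add_gl (a b : Igl n) : (a + b).gl = a.gl + b.gl := rfl
@[simp] theorem add_tr (a b : Igl n) : (a + b).tr = a.tr + b.tr := rfl
@[simp] theorem smul_gl (c : ℂ) (a : Igl n) : (c • a).gl = c • a.gl := rfl
@[simp] theorem smul_tr (c : ℂ) (a : Igl n) : (c • a).tr = c • a.tr := rfl
@[simp] theorem lie_gl (a b : Igl n) : ⁅a, b⁆.gl = a.gl * b.gl - b.gl * a.gl := rfl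
@[simp] theorem lie_tr (a b : Igl n) :
    ⁅a, b⁆.tr = b.gl.transpose.mulVec a.tr - a.gl.transpose.mulVec b.tr := rfl

instance : LieRing (Igl n) where
  add_lie a b c := by
    ext1
    · simp only [lie_gl, add_gl]; noncomm_ring
    · simp only [lie_tr, add_gl, add_tr, Matrix.transpose_add, Matrix.add_mulVec,
        Matrix.mulVec_add]; abel
  lie_add a b c := by
    ext1
    · simp only [lie_gl, add_gl]; noncomm_ring
    · simp only [lie_tr, add_gl, add_tr, Matrix.transpose_add, Matrix.add_mulVec,
        Matrix.mulVec_add]; abel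
  lie_self a := by ext1 <;> simp
  leibniz_lie a b c := by
    ext1
    · simp only [lie_gl, add_gl]; noncomm_ring
    · simp only [lie_tr, lie_gl, add_tr, Matrix.transpose_sub, Matrix.transpose_mul,
        Matrix.sub_mulVec, Matrix.mulVec_sub, Matrix.mulVec_mulVec]; abel

instance : LieAlgebra ℂ (Igl n) where
  lie_smul c a b := by
    ext1
    · simp [smul_sub]
    · simp [smul_sub, Matrix.mulVec_smul, Matrix.smul_mulVec]

/-- The generator `L^μ_ν`. -/
def L (μ ν : Fin n) : Igl n := ⟨-Complex.I • Matrix.single μ ν 1, 0⟩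

/-- The generator `P_μ`. -/
def P (μ : Fin n) : Igl n := ⟨0, Pi.single μ 1⟩

/-- `[L^μ_ν, L^ρ_l] = -i δ^ρ_ν L^μ_l + i δ^μ_l L^ρ_ν`. -/
theorem lie_L_L (μ ν ρ l : Fin n) :
    ⁅L μ ν, L ρ l⁆ = (if ρ = ν then -Complex.I else 0) • L μ l +
      (if μ = l then Complex.I else 0) • L ρ ν := by
  ext1
  · simp only [L, lie_gl, add_gl, smul_gl, Matrix.smul_mul, Matrix.mul_smul, smul_smul]
    by_cases h1 : ρ = ν <;> by_cases h2 : μ = l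
    · subst h1 h2; simp [sub_eq_add_neg]
    · subst h1; simp [h2, Matrix.single_mul_single_of_ne, Ne.symm h2]
    · subst h2; simp [h1, Matrix.single_mul_single_of_ne, Ne.symm h1]
    · simp [h1, h2, Matrix.single_mul_single_of_ne, Ne.symm h1, Ne.symm h2]
  · simp only [L, lie_tr, add_tr, smul_tr]; simp

/-- `[L^μ_ν, P_l] = i δ^μ_l P_ν`. -/
theorem lie_L_P (μ ν l : Fin n) :
    ⁅L μ ν, P l⁆ = (if μ = l then Complex.I else 0) • P ν := by
  ext1
  · simp only [L, P, lie_gl, smul_gl]; simp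
  · ext k
    by_cases h : μ = l
    · subst h
      simp [L, P, Matrix.single_apply, Pi.single_apply, eq_comm]
    · simp [L, P, h]

/-- `[P_μ, P_ν] = 0`. -/
theorem lie_P_P (μ ν : Fin n) : ⁅P μ, P ν⁆ = (0 : Igl n) := by
  ext1
  · simp [P]
  · simp only [P, lie_tr, Matrix.transpose_zero, Matrix.zero_mulVec, sub_zero, zero_tr]

end Igl

attribute [local instance 100] LieRing.ofAssociativeRing
attribute [local instance 100] LieAlgebra.ofAssociativeAlgebra

/-! ### The Hopf algebra `U(𝔦𝔤𝔩(n))` and its action on polynomials -/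

/-- The enveloping algebra `U(𝔦𝔤𝔩(n))`. -/
abbrev U (n : ℕ) : Type := UniversalEnvelopingAlgebra ℂ (Igl n)

/-- The inclusion `𝔦𝔤𝔩(n) → U(𝔦𝔤𝔩(n))`. -/
def inc (n : ℕ) : Igl n →ₗ⁅ℂ⁆ U n := UniversalEnvelopingAlgebra.ι ℂ

/-- The primitive coproduct `Δ(u) = u ⊗ 1 + 1 ⊗ u`, `u ∈ 𝔦𝔤𝔩(n)`. -/
def coproduct (n : ℕ) : U n →ₐ[ℂ] U n ⊗[ℂ] U n :=
  UniversalEnvelopingAlgebra.lift ℂ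
    { toFun := fun u => inc n u ⊗ₜ[ℂ] 1 + 1 ⊗ₜ[ℂ] inc n u
      map_add' := fun u v => by
        rw [map_add, TensorProduct.add_tmul, TensorProduct.tmul_add]; abel
      map_smul' := fun c u => by
        simp [TensorProduct.smul_tmul', TensorProduct.tmul_smul, smul_add]
      map_lie' := fun {u v} => by
        simp only [LieHom.map_lie, LieRing.of_associative_ring_bracket, mul_add, add_mul,
          Algebra.TensorProduct.tmul_mul_tmul, one_mul, mul_one, TensorProduct.sub_tmul,
          TensorProduct.tmul_sub]
        abel }

/-- The counit, `ε(u) = 0` for `u ∈ 𝔦𝔤𝔩(n)`. -/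
def counit (n : ℕ) : U n →ₐ[ℂ] ℂ := UniversalEnvelopingAlgebra.lift ℂ 0

/-- The coordinate algebra `𝔛ⁿ = ℂ[x⁰, …, xⁿ⁻¹]`. -/
abbrev Coord (n : ℕ) : Type := MvPolynomial (Fin n) ℂ

/-- The derivation by which `u ∈ 𝔦𝔤𝔩(n)` acts on `𝔛ⁿ`. -/
def vectorField {n : ℕ} (u : Igl n) : Derivation ℂ (Coord n) (Coord n) :=
  MvPolynomial.mkDerivation ℂ fun ρ =>
    ∑ μ, u.gl μ ρ • MvPolynomial.X μ + MvPolynomial.C (-Complex.I * u.tr ρ)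

theorem vectorField_X {n : ℕ} (u : Igl n) (ρ : Fin n) :
    vectorField u (MvPolynomial.X ρ) =
      ∑ μ, u.gl μ ρ • MvPolynomial.X μ + MvPolynomial.C (-Complex.I * u.tr ρ) :=
  MvPolynomial.mkDerivation_X _ _ _

theorem vectorField_add {n : ℕ} (u v : Igl n) :
    vectorField (u + v) = vectorField u + vectorField v := by
  apply MvPolynomial.derivation_ext
  intro ρ
  simp only [Derivation.add_apply, vectorField_X, Igl.add_gl, Igl.add_tr, Matrix.add_apply,
    Pi.add_apply, add_smul, Finset.sum_add_distrib, mul_add, map_add]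
  abel

theorem vectorField_smul {n : ℕ} (c : ℂ) (u : Igl n) :
    vectorField (c • u) = c • vectorField u := by
  apply MvPolynomial.derivation_ext
  intro ρ
  simp only [Derivation.smul_apply, vectorField_X, Igl.smul_gl, Igl.smul_tr, Matrix.smul_apply,
    Pi.smul_apply, smul_eq_mul, smul_add, Finset.smul_sum, MvPolynomial.smul_eq_C_mul,
    map_mul]
  congr 1
  · exact Finset.sum_congr rfl fun μ _ => mul_assoc _ _ _
  · ring

theorem vectorField_comp_X {n : ℕ} (u v : Igl n) (ρ : Fin n) :
    vectorField u (vectorField v (MvPolynomial.X ρ)) =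
      ∑ μ, (u.gl * v.gl) μ ρ • MvPolynomial.X μ +
        MvPolynomial.C (-Complex.I * v.gl.transpose.mulVec u.tr ρ) := by
  have h1 : ∀ c : ℂ, vectorField u (MvPolynomial.C c) = 0 := fun c =>
    (vectorField u).map_algebraMap c
  rw [vectorField_X]
  simp only [map_add, map_sum, Derivation.map_smul, vectorField_X, h1, add_zero, smul_add,
    Finset.sum_add_distrib]
  congr 1
  · simp only [Finset.smul_sum, smul_smul, Matrix.mul_apply, Finset.sum_smul]
    rw [Finset.sum_comm]
    simp only [mul_comm]
  · simp only [Matrix.mulVec, dotProduct, Matrix.transpose_apply, Finset.mul_sum, map_sum,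
      MvPolynomial.smul_eq_C_mul, ← map_mul]
    refine Finset.sum_congr rfl fun μ _ => ?_
    congr 1
    ring

theorem vectorField_lie {n : ℕ} (u v : Igl n) :
    vectorField ⁅u, v⁆ = ⁅vectorField u, vectorField v⁆ := by
  apply MvPolynomial.derivation_ext
  intro ρ
  rw [Derivation.commutator_apply, vectorField_comp_X, vectorField_comp_X, vectorField_X]
  simp only [Igl.lie_gl, Igl.lie_tr, Matrix.sub_apply, Pi.sub_apply, sub_smul,
    Finset.sum_sub_distrib, mul_sub, map_sub]
  abel

/-- The Hopf action `▷` of `U(𝔦𝔤𝔩(n))` on `𝔛ⁿ`; on generators it is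
`P_μ ▷ x^ν = -i δ_μ^ν`, `L^μ_ν ▷ x^ρ = -i δ_ν^ρ x^μ`. -/
def action (n : ℕ) : U n →ₐ[ℂ] Module.End ℂ (Coord n) :=
  UniversalEnvelopingAlgebra.lift ℂ
    { toFun := fun u => (vectorField u : Coord n →ₗ[ℂ] Coord n)
      map_add' := fun u v => by rw [vectorField_add]; rfl
      map_smul' := fun c u => by rw [vectorField_smul]; rfl
      map_lie' := fun {u v} => by rw [vectorField_lie, Derivation.commutator_coe_linear_map] }

theorem action_inc {n : ℕ} (u : Igl n) (f : Coord n) :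
    action n (inc n u) f = vectorField u f := by
  unfold action inc
  rw [UniversalEnvelopingAlgebra.lift_ι_apply]
  rfl

/-- `P_μ ▷ x^ν = -i δ_μ^ν`. -/
theorem action_P_X {n : ℕ} (μ ν : Fin n) :
    action n (inc n (Igl.P μ)) (MvPolynomial.X ν) =
      MvPolynomial.C (if μ = ν then -Complex.I else 0) := by
  rw [action_inc, vectorField_X]
  by_cases h : μ = ν
  · subst h; simp [Igl.P]
  · simp [Igl.P, h, Ne.symm h]

/-- `L^μ_ν ▷ x^ρ = -i δ_ν^ρ x^μ`. -/
theorem action_L_X {n : ℕ} (μ ν ρ : Fin n) :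
    action n (inc n (Igl.L μ ν)) (MvPolynomial.X ρ) =
      (if ν = ρ then -Complex.I else 0) • MvPolynomial.X μ := by
  rw [action_inc, vectorField_X, Finset.sum_eq_single μ]
  · by_cases h : ν = ρ
    · subst h; simp [Igl.L]
    · simp [Igl.L, h]
  · intro σ _ hσ
    simp [Igl.L, Ne.symm hσ]
  · simp

/-- For fixed `f`, the linear map `u ↦ u ▷ f`. -/
def actOn {n : ℕ} (f : Coord n) : U n →ₗ[ℂ] Coord n := (action n).toLinearMap.flip f

theorem actOn_add {n : ℕ} (f g : Coord n) : actOn (f + g) = actOn f + actOn g :=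
  map_add _ f g

theorem actOn_smul {n : ℕ} (c : ℂ) (f : Coord n) : actOn (c • f) = c • actOn f :=
  map_smul _ c f

/-- The momentum algebra `𝔗ⁿ = ℂ[P₀, …, Pₙ₋₁]`, as a subalgebra of `U(𝔦𝔤𝔩(n))`. -/
def momenta (n : ℕ) : Subalgebra ℂ (U n) :=
  Algebra.adjoin ℂ (Set.range fun μ : Fin n => inc n (Igl.P μ))

/-! ### The Weyl algebra and the Heisenberg realization -/

/-- The generators of the Weyl algebra. -/
inductive WeylGen (n : ℕ) : Type
  | x (μ : Fin n)
  | P (μ : Fin n)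

/-- The relations `[x^μ, x^ν] = 0`, `[P_μ, P_ν] = 0`, `[P_μ, x^ν] = -i δ_μ^ν`. -/
inductive WeylRel (n : ℕ) : FreeAlgebra ℂ (WeylGen n) → FreeAlgebra ℂ (WeylGen n) → Prop
  | xx (μ ν : Fin n) : WeylRel n
      (FreeAlgebra.ι ℂ (.x μ) * FreeAlgebra.ι ℂ (.x ν))
      (FreeAlgebra.ι ℂ (.x ν) * FreeAlgebra.ι ℂ (.x μ))
  | PP (μ ν : Fin n) : WeylRel n
      (FreeAlgebra.ι ℂ (.P μ) * FreeAlgebra.ι ℂ (.P ν))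
      (FreeAlgebra.ι ℂ (.P ν) * FreeAlgebra.ι ℂ (.P μ))
  | Px (μ ν : Fin n) : WeylRel n
      (FreeAlgebra.ι ℂ (.P μ) * FreeAlgebra.ι ℂ (.x ν))
      (FreeAlgebra.ι ℂ (.x ν) * FreeAlgebra.ι ℂ (.P μ) +
        algebraMap ℂ _ (if μ = ν then -Complex.I else 0))

/-- The Weyl algebra `𝔚ⁿ`. -/
def Weyl (n : ℕ) : Type := RingQuot (WeylRel n)

namespace Weyl

variable {n : ℕ}

instance : Ring (Weyl n) := inferInstanceAs (Ring (RingQuot (WeylRel n)))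

instance : Algebra ℂ (Weyl n) := inferInstanceAs (Algebra ℂ (RingQuot (WeylRel n)))

/-- The quotient map. -/
def quot (n : ℕ) : FreeAlgebra ℂ (WeylGen n) →ₐ[ℂ] Weyl n := RingQuot.mkAlgHom ℂ (WeylRel n)

theorem quot_rel {a b : FreeAlgebra ℂ (WeylGen n)} (h : WeylRel n a b) : quot n a = quot n b :=
  RingQuot.mkAlgHom_rel ℂ h

/-- The generator `x^μ` of the Weyl algebra. -/
def x (μ : Fin n) : Weyl n := quot n (FreeAlgebra.ι ℂ (.x μ))

/-- The generator `P_μ` of the Weyl algebra. -/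
def P (μ : Fin n) : Weyl n := quot n (FreeAlgebra.ι ℂ (.P μ))

theorem x_mul_x (μ ν : Fin n) : x μ * x ν = x ν * x μ := by
  simpa only [map_mul, x] using quot_rel (WeylRel.xx μ ν)

theorem P_mul_P (μ ν : Fin n) : P μ * P ν = P ν * P μ := by
  simpa only [map_mul, P] using quot_rel (WeylRel.PP μ ν)

theorem P_mul_x (μ ν : Fin n) :
    P μ * x ν = x ν * P μ + algebraMap ℂ (Weyl n) (if μ = ν then -Complex.I else 0) := by
  simpa only [map_mul, map_add, AlgHom.commutes, x, P] using quot_rel (WeylRel.Px μ ν)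

/-- The embedding `𝔛ⁿ → 𝔚ⁿ`, `x^μ ↦ x^μ`. -/
def ofCoord (n : ℕ) : Coord n →ₐ[ℂ] Weyl n :=
  letI : CommRing (Algebra.adjoin ℂ (Set.range (x : Fin n → Weyl n))) :=
    { (Algebra.adjoin ℂ (Set.range (x : Fin n → Weyl n))).toRing with
      mul_comm := (Algebra.isMulCommutative_adjoin ℂ (by
        rintro _ ⟨μ, rfl⟩ _ ⟨ν, rfl⟩
        exact x_mul_x μ ν)).is_comm.comm }
  (Algebra.adjoin ℂ (Set.range (x : Fin n → Weyl n))).val.comp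
    (MvPolynomial.aeval fun μ => ⟨x μ, Algebra.subset_adjoin ⟨μ, rfl⟩⟩)

theorem ofCoord_X (μ : Fin n) : ofCoord n (MvPolynomial.X μ) = x μ := by
  unfold ofCoord
  simp

theorem lie_P_P (μ ν : Fin n) : ⁅P μ, P ν⁆ = (0 : Weyl n) := by
  rw [LieRing.of_associative_ring_bracket, P_mul_P, sub_self]

theorem lie_xP_P (μ ν l : Fin n) :
    ⁅x μ * P ν, P l⁆ = (if l = μ then Complex.I else 0) • (P ν : Weyl n) := by
  have h : P l * (x μ * P ν) =
      x μ * P ν * P l + algebraMap ℂ (Weyl n) (if l = μ then -Complex.I else 0) * P ν := by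
    rw [← mul_assoc, P_mul_x, add_mul, mul_assoc, mul_assoc, P_mul_P l ν]
  rw [LieRing.of_associative_ring_bracket, h, ← Algebra.smul_def]
  split_ifs <;> simp

theorem lie_xP_xP (μ ν ρ l : Fin n) :
    ⁅x μ * P ν, x ρ * P l⁆ = (if ν = ρ then -Complex.I else 0) • (x μ * P l : Weyl n) +
      (if l = μ then Complex.I else 0) • (x ρ * P ν) := by
  have h : ∀ α β γ δ : Fin n, (x α * P β) * (x γ * P δ) = x α * x γ * (P β * P δ) +
      (if β = γ then -Complex.I else 0) • (x α * P δ : Weyl n) := by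
    intro α β γ δ
    rw [mul_assoc, ← mul_assoc (P β), P_mul_x, add_mul, mul_add, Algebra.smul_def,
      Algebra.left_comm]
    simp only [mul_assoc]
  rw [LieRing.of_associative_ring_bracket, h, h, x_mul_x ρ μ, P_mul_P l ν, add_sub_add_left_eq_sub]
  split_ifs <;> simp

theorem lie_gl_gl (A B : Matrix (Fin n) (Fin n) ℂ) :
    ⁅∑ μ, ∑ ν, (Complex.I * A μ ν) • (x μ * P ν : Weyl n),
      ∑ μ, ∑ ν, (Complex.I * B μ ν) • (x μ * P ν : Weyl n)⁆ =
    ∑ μ, ∑ ν, (Complex.I * (A * B - B * A) μ ν) • (x μ * P ν) := by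
  have h : ∀ μ ν ρ l : Fin n,
      (Complex.I * A μ ν) • (Complex.I * B ρ l) • ⁅x μ * P ν, (x ρ * P l : Weyl n)⁆ =
      (if ν = ρ then (Complex.I * (A μ ν * B ρ l)) • (x μ * P l : Weyl n) else 0) -
      (if l = μ then (Complex.I * (B ρ l * A μ ν)) • (x ρ * P ν : Weyl n) else 0) := by
    intro μ ν ρ l
    rw [lie_xP_xP, smul_smul, smul_add, smul_smul, smul_smul, sub_eq_add_neg]
    have e1 : Complex.I * A μ ν * (Complex.I * B ρ l) * -Complex.I =
        Complex.I * (A μ ν * B ρ l) := by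
      linear_combination (-Complex.I * A μ ν * B ρ l) * Complex.I_mul_I
    have e2 : Complex.I * A μ ν * (Complex.I * B ρ l) * Complex.I =
        -(Complex.I * (B ρ l * A μ ν)) := by
      linear_combination (Complex.I * A μ ν * B ρ l) * Complex.I_mul_I
    congr 1
    · split_ifs
      · rw [e1]
      · simp
    · split_ifs
      · rw [e2, neg_smul]
      · simp
  have h' : ⁅∑ μ, ∑ ν, (Complex.I * A μ ν) • (x μ * P ν : Weyl n),
      ∑ μ, ∑ ν, (Complex.I * B μ ν) • (x μ * P ν : Weyl n)⁆ =
      ∑ μ, ∑ ν, ∑ ρ, ∑ l,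
        (Complex.I * A μ ν) • (Complex.I * B ρ l) • ⁅x μ * P ν, (x ρ * P l : Weyl n)⁆ := by
    rw [sum_lie]
    refine Finset.sum_congr rfl fun μ _ => ?_
    rw [sum_lie]
    refine Finset.sum_congr rfl fun ν _ => ?_
    rw [lie_sum]
    refine Finset.sum_congr rfl fun ρ _ => ?_
    rw [lie_sum]
    refine Finset.sum_congr rfl fun l _ => ?_
    rw [smul_lie, lie_smul]
  rw [h']
  simp only [h, Finset.sum_sub_distrib, Matrix.sub_apply, mul_sub, sub_smul, Matrix.mul_apply,
    Finset.mul_sum, Finset.sum_smul]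
  congr 1
  · refine Finset.sum_congr rfl fun μ _ => ?_
    rw [Finset.sum_comm]
    simp only [Finset.sum_ite_irrel, Finset.sum_const_zero, Finset.sum_ite_eq',
      Finset.mem_univ, if_true]
    rw [Finset.sum_comm]
  · simp only [Finset.sum_ite_eq', Finset.mem_univ, if_true]
    rw [Finset.sum_comm]
    refine (Finset.sum_congr rfl fun ν _ => Finset.sum_comm).trans ?_
    rw [Finset.sum_comm]

theorem lie_gl_tr (A : Matrix (Fin n) (Fin n) ℂ) (v : Fin n → ℂ) :
    ⁅∑ μ, ∑ ν, (Complex.I * A μ ν) • (x μ * P ν : Weyl n), ∑ l, v l • (P l : Weyl n)⁆ =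
    -∑ ν, A.transpose.mulVec v ν • P ν := by
  have h : ∀ μ ν l : Fin n, (Complex.I * A μ ν) • v l • ⁅x μ * P ν, (P l : Weyl n)⁆ =
      -(if l = μ then (A μ ν * v l) • (P ν : Weyl n) else 0) := by
    intro μ ν l
    rw [lie_xP_P, smul_smul, smul_smul]
    have e1 : Complex.I * A μ ν * v l * Complex.I = -(A μ ν * v l) := by
      linear_combination (A μ ν * v l) * Complex.I_mul_I
    split_ifs
    · rw [e1, neg_smul]
    · simp
  have h' : ⁅∑ μ, ∑ ν, (Complex.I * A μ ν) • (x μ * P ν : Weyl n), ∑ l, v l • (P l : Weyl n)⁆ =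
      ∑ μ, ∑ ν, ∑ l, (Complex.I * A μ ν) • v l • ⁅x μ * P ν, (P l : Weyl n)⁆ := by
    rw [sum_lie]
    refine Finset.sum_congr rfl fun μ _ => ?_
    rw [sum_lie]
    refine Finset.sum_congr rfl fun ν _ => ?_
    rw [lie_sum]
    refine Finset.sum_congr rfl fun l _ => ?_
    rw [smul_lie, lie_smul]
  rw [h']
  simp only [h, Finset.sum_neg_distrib, Matrix.mulVec, dotProduct, Matrix.transpose_apply,
    Finset.sum_smul, Finset.sum_ite_eq', Finset.mem_univ, if_true]
  rw [Finset.sum_comm]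

/-- The Lie algebra homomorphism `𝔦𝔤𝔩(n) → 𝔚ⁿ` with `P_μ ↦ P_μ`, `L^μ_ν ↦ x^μ P_ν`. -/
def heisenbergLie (n : ℕ) : Igl n →ₗ⁅ℂ⁆ Weyl n where
  toFun u := ∑ μ, ∑ ν, (Complex.I * u.gl μ ν) • (x μ * P ν) + ∑ ν, u.tr ν • P ν
  map_add' u v := by
    simp only [Igl.add_gl, Igl.add_tr, Matrix.add_apply, Pi.add_apply, mul_add, add_smul,
      Finset.sum_add_distrib]
    abel
  map_smul' c u := by
    simp only [Igl.smul_gl, Igl.smul_tr, Matrix.smul_apply, Pi.smul_apply, smul_eq_mul, smul_add,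
      Finset.smul_sum, smul_smul, RingHom.id_apply, mul_left_comm]
  map_lie' {u v} := by
    have h : ⁅∑ l, u.tr l • (P l : Weyl n), ∑ l, v.tr l • (P l : Weyl n)⁆ = 0 := by
      simp only [sum_lie, lie_sum, smul_lie, lie_smul, lie_P_P, smul_zero, Finset.sum_const_zero]
    rw [add_lie, lie_add, lie_add, lie_gl_gl, lie_gl_tr, h,
      ← lie_skew (∑ l, u.tr l • (P l : Weyl n)), lie_gl_tr]
    simp only [Igl.lie_gl, Igl.lie_tr, Pi.sub_apply, sub_smul, Finset.sum_sub_distrib]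
    abel

/-- The Heisenberg realization `U(𝔦𝔤𝔩(n)) → 𝔚ⁿ`. -/
def heisenberg (n : ℕ) : U n →ₐ[ℂ] Weyl n :=
  UniversalEnvelopingAlgebra.lift ℂ (heisenbergLie n)

theorem heisenberg_P (μ : Fin n) : heisenberg n (inc n (Igl.P μ)) = P μ := by
  unfold heisenberg inc
  rw [UniversalEnvelopingAlgebra.lift_ι_apply]
  simp [heisenbergLie, Igl.P, Pi.single_apply]

theorem heisenberg_L (μ ν : Fin n) : heisenberg n (inc n (Igl.L μ ν)) = x μ * P ν := by
  unfold heisenberg inc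
  rw [UniversalEnvelopingAlgebra.lift_ι_apply]
  simp [heisenbergLie, Igl.L, Matrix.single_apply, ite_and]

/-- The Heisenberg realization of the smash product `𝔛ⁿ ⋊ U(𝔦𝔤𝔩(n)) → 𝔚ⁿ`,
`f ⊗ u ↦ f · heisenberg u`. -/
def realize (n : ℕ) : Coord n ⊗[ℂ] U n →ₗ[ℂ] Weyl n :=
  LinearMap.mul' ℂ (Weyl n) ∘ₗ
    TensorProduct.map (ofCoord n).toLinearMap (heisenberg n).toLinearMap

end Weyl

/-! ### Drinfeld twists and the deformed structures -/

section Twist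

variable {n : ℕ}

/-- `F ∈ (U ⊗ U)[[h]]` is a Drinfeld twist: it is invertible, congruent to `1 ⊗ 1` modulo `h`,
satisfies the 2-cocycle condition `F₁₂ (Δ ⊗ id) F = F₂₃ (id ⊗ Δ) F`
and is normalized, `(ε ⊗ id) F = 1 = (id ⊗ ε) F`. -/
structure IsTwist (F : ((U n ⊗[ℂ] U n)⟦X⟧)ˣ) : Prop where
  constantCoeff : PowerSeries.constantCoeff (F : (U n ⊗[ℂ] U n)⟦X⟧) = 1
  cocycle :
    PowerSeries.map (((Algebra.TensorProduct.assoc ℂ ℂ ℂ (U n) (U n) (U n)).toAlgHom.comp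
        Algebra.TensorProduct.includeLeft : U n ⊗[ℂ] U n →ₐ[ℂ] U n ⊗[ℂ] (U n ⊗[ℂ] U n)) :
          U n ⊗[ℂ] U n →+* U n ⊗[ℂ] (U n ⊗[ℂ] U n)) F *
      PowerSeries.map (((Algebra.TensorProduct.assoc ℂ ℂ ℂ (U n) (U n) (U n)).toAlgHom.comp
        (Algebra.TensorProduct.map (coproduct n) (AlgHom.id ℂ (U n))) :
          U n ⊗[ℂ] U n →ₐ[ℂ] U n ⊗[ℂ] (U n ⊗[ℂ] U n)) :
          U n ⊗[ℂ] U n →+* U n ⊗[ℂ] (U n ⊗[ℂ] U n)) F =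
    PowerSeries.map ((Algebra.TensorProduct.includeRight :
          U n ⊗[ℂ] U n →ₐ[ℂ] U n ⊗[ℂ] (U n ⊗[ℂ] U n)) :
          U n ⊗[ℂ] U n →+* U n ⊗[ℂ] (U n ⊗[ℂ] U n)) F *
      PowerSeries.map ((Algebra.TensorProduct.map (AlgHom.id ℂ (U n)) (coproduct n) :
          U n ⊗[ℂ] U n →ₐ[ℂ] U n ⊗[ℂ] (U n ⊗[ℂ] U n)) :
          U n ⊗[ℂ] U n →+* U n ⊗[ℂ] (U n ⊗[ℂ] U n)) F
  counit_left :
    PowerSeries.map (((Algebra.TensorProduct.lid ℂ (U n)).toAlgHom.comp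
        (Algebra.TensorProduct.map (counit n) (AlgHom.id ℂ (U n))) :
          U n ⊗[ℂ] U n →ₐ[ℂ] U n) : U n ⊗[ℂ] U n →+* U n) F = 1
  counit_right :
    PowerSeries.map (((Algebra.TensorProduct.rid ℂ ℂ (U n)).toAlgHom.comp
        (Algebra.TensorProduct.map (AlgHom.id ℂ (U n)) (counit n)) :
          U n ⊗[ℂ] U n →ₐ[ℂ] U n) : U n ⊗[ℂ] U n →+* U n) F = 1

/-- The deformed coproduct `Δ^F(u) = F Δ(u) F⁻¹`. -/
def twistedCoproduct (F : ((U n ⊗[ℂ] U n)⟦X⟧)ˣ) : U n →ₗ[ℂ] (U n ⊗[ℂ] U n)⟦X⟧ :=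
  LinearMap.mulLeft ℂ (F : (U n ⊗[ℂ] U n)⟦X⟧) ∘ₗ
    LinearMap.mulRight ℂ ((F⁻¹ : ((U n ⊗[ℂ] U n)⟦X⟧)ˣ) : (U n ⊗[ℂ] U n)⟦X⟧) ∘ₗ
      hconst ∘ₗ (coproduct n).toLinearMap

/-- The star product `f ⋆ g = m (F⁻¹ ▷ (f ⊗ g))` of `f, g ∈ 𝔛ⁿ`; its `ℂ[[h]]`-bilinear extension
is the product of `𝔛ⁿ[[h]]^F`. -/
def starProduct (F : ((U n ⊗[ℂ] U n)⟦X⟧)ˣ) : Coord n →ₗ[ℂ] Coord n →ₗ[ℂ] (Coord n)⟦X⟧ :=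
  LinearMap.mk₂ ℂ
    (fun f g => hmap (LinearMap.mul' ℂ (Coord n) ∘ₗ TensorProduct.map (actOn f) (actOn g))
      ((F⁻¹ : ((U n ⊗[ℂ] U n)⟦X⟧)ˣ) : (U n ⊗[ℂ] U n)⟦X⟧))
    (fun f f' g => by
      rw [actOn_add, TensorProduct.map_add_left, LinearMap.comp_add, hmap_add])
    (fun c f g => by
      rw [actOn_smul, TensorProduct.map_smul_left, LinearMap.comp_smul, hmap_smul])
    (fun f g g' => by
      rw [actOn_add, TensorProduct.map_add_right, LinearMap.comp_add, hmap_add])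
    (fun c f g => by
      rw [actOn_smul, TensorProduct.map_smul_right, LinearMap.comp_smul, hmap_smul])

/-- The linear map `u ⊗ v ↦ (u ▷ g) ⊗ v`. -/
def actLeft (g : Coord n) : U n ⊗[ℂ] U n →ₗ[ℂ] Coord n ⊗[ℂ] U n :=
  TensorProduct.map (actOn g) LinearMap.id

theorem actLeft_add (f g : Coord n) : actLeft (f + g) = actLeft f + actLeft g := by
  rw [actLeft, actOn_add, TensorProduct.map_add_left]; rfl

theorem actLeft_smul (c : ℂ) (f : Coord n) : actLeft (c • f) = c • actLeft f := by
  rw [actLeft, actOn_smul, TensorProduct.map_smul_left]; rfl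

/-- The linear map `k ⊗ v ↦ k ⊗ v w`. -/
def mulMom (w : U n) : Coord n ⊗[ℂ] U n →ₗ[ℂ] Coord n ⊗[ℂ] U n :=
  TensorProduct.map LinearMap.id (LinearMap.mulRight ℂ w)

theorem mulMom_add (v w : U n) : mulMom (v + w) = mulMom v + mulMom w := by
  ext f u
  simp [mulMom, mul_add, TensorProduct.tmul_add]

theorem mulMom_smul (c : ℂ) (w : U n) : mulMom (c • w) = c • mulMom w := by
  ext f u
  simp [mulMom]

/-- The linear map `k ⊗ v ↦ (f ⋆ k) ⊗ v`. -/
def starLeft (F : ((U n ⊗[ℂ] U n)⟦X⟧)ˣ) (f : Coord n) :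
    Coord n ⊗[ℂ] U n →ₗ[ℂ] (Coord n ⊗[ℂ] U n)⟦X⟧ :=
  TensorProduct.lift (LinearMap.mk₂ ℂ
    (fun k v => hmap ((TensorProduct.mk ℂ (Coord n) (U n)).flip v) (starProduct F f k))
    (fun k k' v => by rw [map_add, map_add])
    (fun c k v => by rw [map_smul, map_smul])
    (fun k v v' => by rw [map_add, hmap_add])
    (fun c k v => by rw [map_smul, hmap_smul]))

theorem starLeft_add (F : ((U n ⊗[ℂ] U n)⟦X⟧)ˣ) (f g : Coord n) :
    starLeft F (f + g) = starLeft F f + starLeft F g := by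
  apply TensorProduct.ext'
  intro k v
  simp [starLeft]

theorem starLeft_smul (F : ((U n ⊗[ℂ] U n)⟦X⟧)ˣ) (c : ℂ) (f : Coord n) :
    starLeft F (c • f) = c • starLeft F f := by
  apply TensorProduct.ext'
  intro k v
  simp [starLeft]

/-- The product of pure tensors in the smash product `𝔛ⁿ[[h]]^F ⋊ U(𝔦𝔤𝔩(n))[[h]]^F`,
`(f ⊗ u) # (g ⊗ w) = f ⋆ (u₍₁₎ ▷ g) ⊗ u₍₂₎ w` with `u₍₁₎ ⊗ u₍₂₎ = Δ^F(u)`. -/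
def smashPure (F : ((U n ⊗[ℂ] U n)⟦X⟧)ˣ) (f : Coord n) (u : U n) (g : Coord n) (w : U n) :
    (Coord n ⊗[ℂ] U n)⟦X⟧ :=
  hmap (mulMom w) (hextend (starLeft F f) (hmap (actLeft g) (twistedCoproduct F u)))

/-- `smashPure` as a bilinear map on `𝔛ⁿ ⊗ U(𝔦𝔤𝔩(n))`. -/
def smashBilin (F : ((U n ⊗[ℂ] U n)⟦X⟧)ˣ) :
    Coord n ⊗[ℂ] U n →ₗ[ℂ] Coord n ⊗[ℂ] U n →ₗ[ℂ] (Coord n ⊗[ℂ] U n)⟦X⟧ :=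
  TensorProduct.lift (LinearMap.mk₂ ℂ
    (fun f u => TensorProduct.lift (LinearMap.mk₂ ℂ (fun g w => smashPure F f u g w)
      (fun g g' w => by simp only [smashPure, actLeft_add, hmap_add, map_add])
      (fun c g w => by simp only [smashPure, actLeft_smul, hmap_smul, map_smul])
      (fun g w w' => by simp only [smashPure, mulMom_add, hmap_add])
      (fun c g w => by simp only [smashPure, mulMom_smul, hmap_smul])))
    (fun f f' u => by
      apply TensorProduct.ext'
      intro g w
      simp [smashPure, starLeft_add, hextend_add])
    (fun c f u => by
      apply TensorProduct.ext'
      intro g w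
      simp [smashPure, starLeft_smul, hextend_smul])
    (fun f u u' => by
      apply TensorProduct.ext'
      intro g w
      simp [smashPure])
    (fun c f u => by
      apply TensorProduct.ext'
      intro g w
      simp [smashPure]))

/-- The product of the smash product `𝔛ⁿ[[h]]^F ⋊ U(𝔦𝔤𝔩(n))[[h]]^F`, whose underlying
`ℂ[[h]]`-module is `(𝔛ⁿ ⊗ U(𝔦𝔤𝔩(n)))[[h]]`. -/
def smash (F : ((U n ⊗[ℂ] U n)⟦X⟧)ˣ) (a b : (Coord n ⊗[ℂ] U n)⟦X⟧) : (Coord n ⊗[ℂ] U n)⟦X⟧ :=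
  hextend₂ (smashBilin F) a b

/-- The underlying `ℂ[[h]]`-module `(𝔛ⁿ ⊗ 𝔗ⁿ)[[h]]` of the deformed Weyl algebra
`𝔚ⁿ[[h]]^F = 𝔛ⁿ[[h]]^F ⋊ 𝔗ⁿ[[h]]^F`, inside `𝔛ⁿ[[h]]^F ⋊ U(𝔦𝔤𝔩(n))[[h]]^F`.
Its product is the restriction of `smash F`. -/
def deformedWeyl (n : ℕ) : Submodule ℂ⟦X⟧ (Coord n ⊗[ℂ] U n)⟦X⟧ where
  carrier := {a | ∀ k, PowerSeries.coeff k a ∈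
    LinearMap.range (TensorProduct.map (LinearMap.id : Coord n →ₗ[ℂ] Coord n)
      (momenta n).val.toLinearMap)}
  add_mem' {a b} ha hb k := by
    rw [map_add]; exact Submodule.add_mem _ (ha k) (hb k)
  zero_mem' k := by
    rw [map_zero]; exact Submodule.zero_mem _
  smul_mem' c a ha k := by
    rw [coeff_hadic_smul]
    exact Submodule.sum_mem _ fun p _ => Submodule.smul_mem _ _ (ha p.2)

theorem const_mem_deformedWeyl (f : Coord n) (p : momenta n) :
    hconst (f ⊗ₜ[ℂ] (p : U n)) ∈ deformedWeyl n := by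
  intro k
  change PowerSeries.coeff k (PowerSeries.C _) ∈ _
  rw [PowerSeries.coeff_C]
  split_ifs
  · exact ⟨f ⊗ₜ[ℂ] p, rfl⟩
  · exact Submodule.zero_mem _

/-- The element `f p = f ⊗ p` of the deformed Weyl algebra. -/
def tensor (f : Coord n) (p : momenta n) : deformedWeyl n :=
  ⟨hconst (f ⊗ₜ[ℂ] (p : U n)), const_mem_deformedWeyl f p⟩

/-- The momenta form a Hopf subalgebra of `U(𝔦𝔤𝔩(n))[[h]]^F`: the deformed coproduct maps `𝔗ⁿ`,
hence `𝔗ⁿ[[h]]`, to `(𝔗ⁿ ⊗ 𝔗ⁿ)[[h]]`. (Stability under the deformed antipode is then automatic,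
and is not required.) -/
def MomentaHopf (F : ((U n ⊗[ℂ] U n)⟦X⟧)ˣ) : Prop :=
  ∀ p ∈ momenta n, ∀ k, PowerSeries.coeff k (twistedCoproduct F p) ∈
    LinearMap.range (TensorProduct.map (momenta n).val.toLinearMap (momenta n).val.toLinearMap)

/-- The element `f̂ = (f̄^α ▷ f) · f̄_α` of `𝔛ⁿ[[h]] ⋊ U(𝔦𝔤𝔩(n))[[h]]`, where
`F⁻¹ = f̄^α ⊗ f̄_α`. -/
def hat (F : ((U n ⊗[ℂ] U n)⟦X⟧)ˣ) (f : Coord n) : (Coord n ⊗[ℂ] U n)⟦X⟧ :=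
  hmap (actLeft f) ((F⁻¹ : ((U n ⊗[ℂ] U n)⟦X⟧)ˣ) : (U n ⊗[ℂ] U n)⟦X⟧)

/-- The element `f̂` in the Heisenberg realization `L^μ_ν ↦ x^μ P_ν`. -/
def realizedHat (F : ((U n ⊗[ℂ] U n)⟦X⟧)ˣ) (f : Coord n) : (Weyl n)⟦X⟧ :=
  hmap (Weyl.realize n) (hat F f)

end Twist

end TwistedWeyl

end

/-! The isomorphism is `f ⊗ p ↦ f̂ p`. It is defined on all of `𝔛ⁿ ⊗ U` by `f ⊗ u ↦ f̂ u`
(`realizeHat`), where `u` is read in the Heisenberg realization, and it is multiplicative there,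
before any restriction to momenta.

Multiplicativity rests on two identities. First, `f ⋆ g` goes to `f̂ ĝ`
(`IsTwist.hextend_hatMap_starProduct`): evaluating three tensor legs as `(u ▷ f)(v ▷ g) w`, the hat
of `f ⋆ g` is the value at `(Δ ⊗ id)F⁻¹ · F₁₂⁻¹` and `f̂ ĝ` is the value at `(id ⊗ Δ)F⁻¹ · F₂₃⁻¹`.
These two elements agree by the inverted cocycle condition. Second, the cross relation `u ĝ = (u₍₁₎
▷ g)^ u₍₂₎`, with the legs of `Δ^F(u)`: the hat contributes a factor `F⁻¹` on the left of `F Δ(u)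
F⁻¹`, so that `Δ(u) F⁻¹` remains, and the undeformed relation `u f = (u₍₁₎ ▷ f) u₍₂₎` holds in the
Weyl algebra (`heisenberg_mul_realizeAct`).

Bijectivity is decided modulo `h`. Since `F⁻¹ ≡ 1 ⊗ 1`, the constant part of the map on `𝔛ⁿ ⊗ 𝔗ⁿ` is
normal ordering `f ⊗ p ↦ f(x) p(P)`. It is onto because its range is stable under left
multiplication by the generators, and injective because the Weyl algebra acts on symbols `f ⊗ q` so
that `f(x) q(P)` sends `1 ⊗ 1` to `f ⊗ q`. A continuous extension inherits injectivity and
surjectivity from its constant part (`hextend_eq_zero`, `hextend_surjective`). Density is again a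
statement modulo `h`: `x̂^μ` has constant term `x^μ`, and errors are removed one order at a time. -/

noncomputable section

namespace TwistedWeyl

attribute [local instance 100] LieRing.ofAssociativeRing
attribute [local instance 100] LieAlgebra.ofAssociativeAlgebra

/-! ### Extending linear maps to power series, and solving equations order by order -/

section Hadic

variable {A B C : Type} [Ring A] [Algebra ℂ A] [Ring B] [Algebra ℂ B] [Ring C] [Algebra ℂ C]

theorem X_pow_smul (N : ℕ) (a : A⟦X⟧) :
    (PowerSeries.X ^ N : ℂ⟦X⟧) • a = PowerSeries.X ^ N * a := by
  rw [Algebra.smul_def]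
  congr 1
  change PowerSeries.map (algebraMap ℂ A) _ = _
  simp

/-- A `ℂ[[h]]`-linear map is determined by its values on constant series. -/
theorem hadic_ext {φ ψ : A⟦X⟧ →ₗ[ℂ⟦X⟧] B⟦X⟧}
    (H : ∀ a : A, φ (PowerSeries.C a) = ψ (PowerSeries.C a)) : φ = ψ := by
  -- Continuity is automatic: write `a = C a₀ + h b`. The difference `φ - ψ` kills `C a₀`, so its
  -- coefficient of order `k + 1` at `a` is that of order `k` at `b`. The induction therefore runs
  -- over all `a` at once.
  have key : ∀ (k : ℕ) (a : A⟦X⟧), PowerSeries.coeff k ((φ - ψ) a) = 0 := by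
    intro k
    induction k with
    | zero =>
      intro a
      obtain ⟨b, hb⟩ := PowerSeries.X_dvd_iff.2
        (show PowerSeries.constantCoeff (a - PowerSeries.C (PowerSeries.constantCoeff a)) = 0 by
          simp)
      have hb' : a = PowerSeries.C (PowerSeries.constantCoeff a) +
          (PowerSeries.X ^ 1 : ℂ⟦X⟧) • b := by
        rw [X_pow_smul, pow_one, ← hb]; abel
      rw [hb', map_add, map_smul, X_pow_smul, LinearMap.sub_apply, H, sub_self]
      simp
    | succ k ih =>
      intro a
      obtain ⟨b, hb⟩ := PowerSeries.X_dvd_iff.2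
        (show PowerSeries.constantCoeff (a - PowerSeries.C (PowerSeries.constantCoeff a)) = 0 by
          simp)
      have hb' : a = PowerSeries.C (PowerSeries.constantCoeff a) +
          (PowerSeries.X ^ 1 : ℂ⟦X⟧) • b := by
        rw [X_pow_smul, pow_one, ← hb]; abel
      rw [hb', map_add, map_smul, X_pow_smul, LinearMap.sub_apply, H, sub_self, zero_add, pow_one,
        PowerSeries.coeff_succ_X_mul, ih]
  refine LinearMap.ext fun a => ?_
  rw [← sub_eq_zero, ← LinearMap.sub_apply]
  ext k
  rw [key, map_zero]

/-- A `ℂ[[h]]`-linear map on `(A ⊗ B)[[h]]` is determined by its values on pure tensors. -/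
theorem hadic_ext_tmul {φ ψ : (A ⊗[ℂ] B)⟦X⟧ →ₗ[ℂ⟦X⟧] C⟦X⟧}
    (H : ∀ a b, φ (PowerSeries.C (a ⊗ₜ b)) = ψ (PowerSeries.C (a ⊗ₜ b))) : φ = ψ := by
  refine hadic_ext fun t => ?_
  induction t using TensorProduct.induction_on with
  | zero => simp
  | tmul a b => exact H a b
  | add s t hs ht => rw [map_add, map_add, map_add, hs, ht]

theorem coeff_hextend (φ : A →ₗ[ℂ] B⟦X⟧) (a : A⟦X⟧) (k : ℕ) :
    PowerSeries.coeff k (hextend φ a) = ∑ p ∈ Finset.HasAntidiagonal.antidiagonal k,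
      PowerSeries.coeff p.2 (φ (PowerSeries.coeff p.1 a)) := by
  simp [hextend]

theorem coeff_hmap (φ : A →ₗ[ℂ] B) (a : A⟦X⟧) (k : ℕ) :
    PowerSeries.coeff k (hmap φ a) = φ (PowerSeries.coeff k a) := by
  simp [hmap]

theorem hextend_hadic_smul (φ : A →ₗ[ℂ] B⟦X⟧) (c : ℂ⟦X⟧) (a : A⟦X⟧) :
    hextend φ (c • a) = c • hextend φ a := by
  ext k
  simp only [coeff_hextend, coeff_hadic_smul, map_sum, map_smul, Finset.smul_sum,
    coeff_complex_smul]
  rw [Finset.sum_sigma', Finset.sum_sigma']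
  -- Both sides sum over triples of orders, taken from `c`, `a` and `φ`, with total `k`; the
  -- bijection only regroups the triple.
  refine Finset.sum_nbij' (fun x => ⟨(x.2.1, x.2.2 + x.1.2), (x.2.2, x.1.2)⟩)
    (fun x => ⟨(x.1.1 + x.2.1, x.2.2), (x.1.1, x.2.1)⟩) ?_ ?_ ?_ ?_ ?_ <;>
  rintro ⟨⟨i, j⟩, ⟨l, m⟩⟩ <;>
  simp only [Finset.mem_sigma, Finset.HasAntidiagonal.mem_antidiagonal] <;>
  rintro ⟨rfl, rfl⟩ <;> simp [add_assoc]

theorem hmap_hadic_smul (φ : A →ₗ[ℂ] B) (c : ℂ⟦X⟧) (a : A⟦X⟧) :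
    hmap φ (c • a) = c • hmap φ a := by
  ext k
  simp only [coeff_hmap, coeff_hadic_smul, map_sum, map_smul]

/-- `hextend φ` as a `ℂ[[h]]`-linear map. -/
def hextendLin (φ : A →ₗ[ℂ] B⟦X⟧) : A⟦X⟧ →ₗ[ℂ⟦X⟧] B⟦X⟧ where
  toFun := hextend φ
  map_add' := map_add _
  map_smul' := hextend_hadic_smul φ

/-- `hmap φ` as a `ℂ[[h]]`-linear map. -/
def hmapLin (φ : A →ₗ[ℂ] B) : A⟦X⟧ →ₗ[ℂ⟦X⟧] B⟦X⟧ where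
  toFun := hmap φ
  map_add' := map_add _
  map_smul' := hmap_hadic_smul φ

theorem hextendLin_apply (φ : A →ₗ[ℂ] B⟦X⟧) (a : A⟦X⟧) : hextendLin φ a = hextend φ a := rfl

theorem hmapLin_apply (φ : A →ₗ[ℂ] B) (a : A⟦X⟧) : hmapLin φ a = hmap φ a := rfl

theorem hmap_C (φ : A →ₗ[ℂ] B) (a : A) :
    hmap φ (PowerSeries.C a) = PowerSeries.C (φ a) := by
  ext k
  rw [coeff_hmap, PowerSeries.coeff_C, PowerSeries.coeff_C]
  split_ifs <;> simp

theorem hextend_C (φ : A →ₗ[ℂ] B⟦X⟧) (a : A) : hextend φ (PowerSeries.C a) = φ a := by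
  ext k
  rw [coeff_hextend, Finset.sum_eq_single (0, k)]
  · simp
  · rintro ⟨i, j⟩ hij h
    have hi : i ≠ 0 := by
      rintro rfl
      rw [Finset.HasAntidiagonal.mem_antidiagonal, zero_add] at hij
      exact h (by simp_all)
    rw [PowerSeries.coeff_C, if_neg hi, map_zero, map_zero]
  · simp

theorem C_smul (c : ℂ) (a : A) :
    (PowerSeries.C (c • a) : A⟦X⟧) = c • (PowerSeries.C a : A⟦X⟧) :=
  map_smul (hconst : A →ₗ[ℂ] A⟦X⟧) c a

theorem hmap_algHom (φ : A →ₐ[ℂ] B) (a : A⟦X⟧) :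
    hmap φ.toLinearMap a = PowerSeries.map (φ : A →+* B) a := by
  ext k
  rw [coeff_hmap, PowerSeries.coeff_map]
  rfl

theorem hextend₂_eq_sum (β : A →ₗ[ℂ] B →ₗ[ℂ] C⟦X⟧) (a : A⟦X⟧) (b : B⟦X⟧) (k : ℕ) :
    PowerSeries.coeff k (hextend₂ β a b) = ∑ p ∈ Finset.HasAntidiagonal.antidiagonal k,
      PowerSeries.coeff p.2 (hextend (β (PowerSeries.coeff p.1 a)) b) := by
  simp only [hextend₂, PowerSeries.coeff_mk, coeff_hextend]

/-- For fixed `b`, the map `a ↦ hextend (β a) b`. -/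
def hextendFlip (β : A →ₗ[ℂ] B →ₗ[ℂ] C⟦X⟧) (b : B⟦X⟧) : A →ₗ[ℂ] C⟦X⟧ where
  toFun a := hextend (β a) b
  map_add' a a' := by rw [map_add, hextend_add]
  map_smul' c a := by rw [map_smul, hextend_smul]; rfl

theorem hextend₂_eq (β : A →ₗ[ℂ] B →ₗ[ℂ] C⟦X⟧) (a : A⟦X⟧) (b : B⟦X⟧) :
    hextend₂ β a b = hextend (hextendFlip β b) a := by
  ext k
  rw [hextend₂_eq_sum, coeff_hextend]
  rfl

/-- Multiplicativity of a `ℂ[[h]]`-linear map with respect to a continuous bilinear product can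
be checked on constant series. -/
theorem map_hextend₂_eq_mul (β : A →ₗ[ℂ] A →ₗ[ℂ] A⟦X⟧) (Φ : A⟦X⟧ →ₗ[ℂ⟦X⟧] B⟦X⟧)
    (H : ∀ a b : A, Φ (β a b) = Φ (PowerSeries.C a) * Φ (PowerSeries.C b)) (a b : A⟦X⟧) :
    Φ (hextend₂ β a b) = Φ a * Φ b := by
  -- One argument at a time: the second leaves the constants here, the first in the next step.
  have h1 : ∀ (a : A) (b : A⟦X⟧), Φ (hextend (β a) b) = Φ (PowerSeries.C a) * Φ b := by
    intro a b
    have : Φ ∘ₗ hextendLin (β a) =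
        LinearMap.mulLeft ℂ⟦X⟧ (Φ (PowerSeries.C a)) ∘ₗ Φ := by
      refine hadic_ext fun b => ?_
      simp only [LinearMap.comp_apply, hextendLin_apply, hextend_C, H, LinearMap.mulLeft_apply]
    exact LinearMap.congr_fun this b
  have : Φ ∘ₗ hextendLin (hextendFlip β b) = LinearMap.mulRight ℂ⟦X⟧ (Φ b) ∘ₗ Φ := by
    refine hadic_ext fun a => ?_
    simp only [LinearMap.comp_apply, hextendLin_apply, hextend_C, LinearMap.mulRight_apply]
    exact h1 a b
  rw [hextend₂_eq]
  exact LinearMap.congr_fun this a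

/-- `hextend φ` is injective on the series with coefficients in `S` if the constant part of `φ`
is injective on `S`. -/
theorem hextend_eq_zero {S : Submodule ℂ A} (φ : A →ₗ[ℂ] B⟦X⟧)
    (hφ : ∀ a ∈ S, PowerSeries.constantCoeff (φ a) = 0 → a = 0) (a : A⟦X⟧)
    (ha : ∀ k, PowerSeries.coeff k a ∈ S) (h : hextend φ a = 0) : a = 0 := by
  ext k
  rw [map_zero]
  induction k using Nat.strong_induction_on with
  | _ k ih =>
    refine hφ _ (ha k) ?_
    have hk := congrArg (PowerSeries.coeff k) h
    -- The lower coefficients of `a` vanish by induction, so order `k` of the equation sees only the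
    -- constant part of `φ` at the `k`-th coefficient.
    rw [coeff_hextend, map_zero, Finset.sum_eq_single (k, 0)] at hk
    · simpa using hk
    · rintro ⟨i, j⟩ hij hne
      rw [Finset.HasAntidiagonal.mem_antidiagonal] at hij
      have : i < k := by
        rcases Nat.eq_zero_or_pos j with rfl | hj
        · exact absurd (by simp_all) hne
        · simp only at hij; omega
      rw [ih i this, map_zero, map_zero]
    · simp

/-- The coefficients of a solution `a` of `hextend φ a = b`, found recursively from a section `σ`
of the constant part of `φ`. -/
def hextendInv (φ : A →ₗ[ℂ] B⟦X⟧) (σ : B → A) (b : B⟦X⟧) : ℕ → A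
  | k => σ (PowerSeries.coeff k b - ∑ i : Fin k,
      PowerSeries.coeff (k - i) (φ (hextendInv φ σ b i)))

/-- At order `k` the unknown `k`-th coefficient enters only through the constant part of `φ`; the
remaining terms involve coefficients already found, so a preimage of their difference from the
target solves the equation. -/
theorem hextend_surjective {S : Submodule ℂ A} (φ : A →ₗ[ℂ] B⟦X⟧)
    (hφ : ∀ b, ∃ a ∈ S, PowerSeries.constantCoeff (φ a) = b) (b : B⟦X⟧) :
    ∃ a : A⟦X⟧, (∀ k, PowerSeries.coeff k a ∈ S) ∧ hextend φ a = b := by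
  choose σ hσ hσ' using hφ
  refine ⟨PowerSeries.mk (hextendInv φ σ b), fun k => ?_, ?_⟩
  · rw [PowerSeries.coeff_mk, hextendInv]
    exact hσ _
  · ext k
    rw [coeff_hextend, Finset.Nat.sum_antidiagonal_eq_sum_range_succ_mk, Finset.sum_range_succ]
    simp only [PowerSeries.coeff_mk, Nat.sub_self, PowerSeries.coeff_zero_eq_constantCoeff]
    -- Only the top coefficient is unfolded; the lower ones stay folded and cancel against its
    -- correction sum.
    conv_lhs => arg 2; rw [hextendInv]
    rw [hσ', Finset.sum_range]
    abel

theorem hmap_hmap (ψ : B →ₗ[ℂ] C) (φ : A →ₗ[ℂ] B) (a : A⟦X⟧) :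
    hmap ψ (hmap φ a) = hmap (ψ ∘ₗ φ) a := by
  ext k
  simp only [coeff_hmap, LinearMap.comp_apply]

end Hadic

/-! ### The enveloping algebra and its action on polynomials -/

variable {n : ℕ}

/-- A subalgebra of `U(𝔦𝔤𝔩(n))` that contains `𝔦𝔤𝔩(n)` is everything. -/
theorem mem_of_inc_mem (S : Subalgebra ℂ (U n)) (h : ∀ a, inc n a ∈ S) (u : U n) : u ∈ S := by
  -- By the universal property the inclusion of the Lie algebra lifts to a map `U → S`; followed by
  -- `S ⊆ U` it is the identity by uniqueness.
  let f : Igl n →ₗ⁅ℂ⁆ S :=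
    { toFun := fun a => ⟨inc n a, h a⟩
      map_add' := fun a b => Subtype.ext (map_add _ a b)
      map_smul' := fun c a => Subtype.ext (map_smul _ c a)
      map_lie' := fun {a b} => Subtype.ext (LieHom.map_lie _ a b) }
  have : S.val.comp (UniversalEnvelopingAlgebra.lift ℂ f) = AlgHom.id ℂ (U n) := by
    apply UniversalEnvelopingAlgebra.hom_ext
    ext a
    change ((UniversalEnvelopingAlgebra.lift ℂ f (UniversalEnvelopingAlgebra.ι ℂ a) : S) : U n) = _
    rw [UniversalEnvelopingAlgebra.lift_ι_apply]
    rfl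
  have h2 := DFunLike.congr_fun this u
  rw [AlgHom.id_apply] at h2
  rw [← h2]
  exact Subtype.property _

theorem enveloping_induction {p : U n → Prop} (hc : ∀ c, p (algebraMap ℂ _ c))
    (hi : ∀ a, p (inc n a)) (ha : ∀ u v, p u → p v → p (u + v))
    (hm : ∀ u v, p u → p v → p (u * v)) (u : U n) : p u :=
  mem_of_inc_mem (S :=
    { carrier := {u | p u}
      mul_mem' := hm _ _
      add_mem' := ha _ _
      algebraMap_mem' := hc }) hi u

theorem coproduct_inc (a : Igl n) :
    coproduct n (inc n a) = inc n a ⊗ₜ[ℂ] 1 + 1 ⊗ₜ[ℂ] inc n a := by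
  unfold coproduct inc
  rw [UniversalEnvelopingAlgebra.lift_ι_apply]
  rfl

theorem counit_inc (a : Igl n) : counit n (inc n a) = 0 := by
  unfold counit inc
  rw [UniversalEnvelopingAlgebra.lift_ι_apply]
  rfl

theorem action_one (u : U n) : action n u 1 = counit n u • (1 : Coord n) := by
  induction u using enveloping_induction with
  | hc c => simp [Algebra.algebraMap_eq_smul_one]
  | hi a => rw [action_inc, counit_inc, zero_smul]; exact Derivation.map_one_eq_zero _
  | ha u v hu hv => rw [map_add, LinearMap.add_apply, hu, hv, map_add, add_smul]
  | hm u v hu hv => rw [map_mul, Module.End.mul_apply, hv, map_smul, hu, smul_smul, map_mul, mul_comm]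

/-- The bilinear map `u ⊗ v ↦ (u ▷ f) (v ▷ g)`. -/
def actMul (f g : Coord n) : U n ⊗[ℂ] U n →ₗ[ℂ] Coord n :=
  LinearMap.mul' ℂ (Coord n) ∘ₗ TensorProduct.map (actOn f) (actOn g)

theorem actMul_tmul (f g : Coord n) (u v : U n) :
    actMul f g (u ⊗ₜ v) = action n u f * action n v g := rfl

/-- `𝔛ⁿ` is a module algebra. -/
theorem action_actMul (f g : Coord n) (u : U n) (t : U n ⊗[ℂ] U n) :
    action n u (actMul f g t) = actMul f g (coproduct n u * t) := by
  -- The element `t` must vary: for a product `u v`, the hypothesis on `u` is applied at `Δ(v) t`.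
  induction u using enveloping_induction generalizing t with
  | hc c => simp [Algebra.algebraMap_eq_smul_one]
  | hi a =>
    induction t using TensorProduct.induction_on with
    | zero => simp
    | add s t hs ht => rw [map_add, map_add, mul_add, map_add, hs, ht]
    | tmul v w =>
      rw [coproduct_inc, add_mul, Algebra.TensorProduct.tmul_mul_tmul,
        Algebra.TensorProduct.tmul_mul_tmul, map_add, actMul_tmul, actMul_tmul, actMul_tmul,
        one_mul, one_mul, map_mul (action n), map_mul (action n), Module.End.mul_apply,
        Module.End.mul_apply, action_inc, action_inc, action_inc, Derivation.leibniz,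
        smul_eq_mul, smul_eq_mul]
      ring
  | ha u v hu hv => rw [map_add, LinearMap.add_apply, hu, hv, map_add, add_mul, map_add]
  | hm u v hu hv => rw [map_mul, Module.End.mul_apply, hv, hu, map_mul (coproduct n), mul_assoc]

/-! ### Commutators with coordinates in the Heisenberg realization -/

namespace Weyl

theorem heisenberg_inc (a : Igl n) : heisenberg n (inc n a) =
    ∑ μ, ∑ ν, (Complex.I * a.gl μ ν) • (x μ * P ν) + ∑ ν, a.tr ν • P ν := by
  unfold heisenberg inc
  rw [UniversalEnvelopingAlgebra.lift_ι_apply]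
  rfl

/-- Moving `x^ρ` to the left past `P_ν` costs `-i δ`. The factor `i` in front of `x^μ P_ν` turns
this into the coefficients of the vector field. -/
theorem heisenberg_inc_mul_x (a : Igl n) (ρ : Fin n) :
    heisenberg n (inc n a) * x ρ =
      x ρ * heisenberg n (inc n a) + ofCoord n (vectorField a (MvPolynomial.X ρ)) := by
  have h1 : ∀ μ ν : Fin n, x μ * P ν * x ρ =
      x ρ * (x μ * P ν) + (if ν = ρ then -Complex.I else 0) • (x μ : Weyl n) := by
    intro μ ν
    rw [mul_assoc, P_mul_x, mul_add, ← mul_assoc, ← mul_assoc, x_mul_x μ ρ, ← Algebra.commutes,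
      ← Algebra.smul_def]
  have h2 : ∀ ν : Fin n, P ν * x ρ =
      x ρ * P ν + (if ν = ρ then -Complex.I else 0) • (1 : Weyl n) := by
    intro ν
    rw [P_mul_x, Algebra.algebraMap_eq_smul_one]
  have e : ∀ z : ℂ, z * Complex.I * Complex.I = -z := fun z => by
    linear_combination z * Complex.I_mul_I
  rw [heisenberg_inc, vectorField_X]
  simp only [add_mul, mul_add, Finset.sum_mul, Finset.mul_sum, smul_mul_assoc, mul_smul_comm, h1,
    h2, smul_add, Finset.sum_add_distrib, smul_smul, map_add, map_sum, map_smul, ofCoord_X]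
  simp [e, MvPolynomial.C_eq_smul_one, mul_comm Complex.I]
  abel

/-- The commutator with a Lie algebra element and its vector field both obey the Leibniz rule, so
agreement on coordinates suffices. -/
theorem heisenberg_inc_mul_ofCoord (a : Igl n) (f : Coord n) :
    heisenberg n (inc n a) * ofCoord n f =
      ofCoord n f * heisenberg n (inc n a) + ofCoord n (vectorField a f) := by
  induction f using MvPolynomial.induction_on with
  | C c =>
    have : vectorField a (MvPolynomial.C c) = 0 := (vectorField a).map_algebraMap c
    rw [this, map_zero, add_zero, ← MvPolynomial.algebraMap_eq, AlgHom.commutes, Algebra.commutes]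
  | add f g hf hg => simp only [map_add, mul_add, add_mul, hf, hg]; abel
  | mul_X f ρ hf =>
    rw [map_mul, ofCoord_X, ← mul_assoc, hf, add_mul, mul_assoc, heisenberg_inc_mul_x,
      Derivation.leibniz, map_add, smul_eq_mul, smul_eq_mul, map_mul, map_mul, ofCoord_X, mul_add,
      mul_assoc, add_assoc, ← ofCoord_X ρ, ← map_mul, ← map_mul _ (MvPolynomial.X ρ),
      mul_comm (MvPolynomial.X ρ), ← map_mul _ (vectorField a f)]

end Weyl

/-! ### Evaluating two and three tensor legs in the Weyl algebra -/

/-- The linear map `u ⊗ v ↦ (u ▷ f) v` in the Heisenberg realization. -/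
def realizeAct (f : Coord n) : U n ⊗[ℂ] U n →ₗ[ℂ] Weyl n := Weyl.realize n ∘ₗ actLeft f

theorem realizeAct_tmul (f : Coord n) (u v : U n) :
    realizeAct f (u ⊗ₜ v) = Weyl.ofCoord n (action n u f) * Weyl.heisenberg n v := rfl

/-- This is the cross relation `u f = (u₍₁₎ ▷ f) u₍₂₎` of the undeformed smash product. For a Lie
algebra element it is the commutator formula, and it passes to products because `Δ` is
multiplicative. -/
theorem heisenberg_mul_realizeAct (f : Coord n) (u : U n) (t : U n ⊗[ℂ] U n) :
    Weyl.heisenberg n u * realizeAct f t = realizeAct f (coproduct n u * t) := by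
  induction u using enveloping_induction generalizing t with
  | hc c => simp [Algebra.algebraMap_eq_smul_one]
  | hi a =>
    induction t using TensorProduct.induction_on with
    | zero => simp
    | add s t hs ht => rw [map_add, mul_add, mul_add, map_add, hs, ht]
    | tmul v w =>
      rw [coproduct_inc, add_mul, Algebra.TensorProduct.tmul_mul_tmul,
        Algebra.TensorProduct.tmul_mul_tmul, map_add, realizeAct_tmul, realizeAct_tmul,
        realizeAct_tmul, one_mul, one_mul, map_mul, map_mul, Module.End.mul_apply, action_inc,
        ← mul_assoc, Weyl.heisenberg_inc_mul_ofCoord, add_mul, mul_assoc, add_comm]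
  | ha u v hu hv => rw [map_add, add_mul, hu, hv, map_add, add_mul, map_add]
  | hm u v hu hv => rw [map_mul, mul_assoc, hv, hu, map_mul (coproduct n), mul_assoc]

theorem realizeAct_mul_tmul (f : Coord n) (t : U n ⊗[ℂ] U n) (u v : U n) :
    realizeAct f (t * u ⊗ₜ v) = realizeAct (action n u f) t * Weyl.heisenberg n v := by
  induction t using TensorProduct.induction_on with
  | zero => simp
  | add s t hs ht => rw [add_mul, map_add, map_add, add_mul, hs, ht]
  | tmul a b =>
    rw [Algebra.TensorProduct.tmul_mul_tmul, realizeAct_tmul, realizeAct_tmul, map_mul, map_mul,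
      Module.End.mul_apply, mul_assoc]

/-- The linear map `u ⊗ v ⊗ w ↦ (u ▷ f) (v ▷ g) w` in the Heisenberg realization. -/
def realizeAct₂ (f g : Coord n) : U n ⊗[ℂ] (U n ⊗[ℂ] U n) →ₗ[ℂ] Weyl n :=
  LinearMap.mul' ℂ (Weyl n) ∘ₗ
    TensorProduct.map ((Weyl.ofCoord n).toLinearMap ∘ₗ actOn f) (realizeAct g)

theorem realizeAct₂_tmul (f g : Coord n) (u : U n) (t : U n ⊗[ℂ] U n) :
    realizeAct₂ f g (u ⊗ₜ t) = Weyl.ofCoord n (action n u f) * realizeAct g t := rfl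

theorem realizeAct₂_assoc (f g : Coord n) (t : U n ⊗[ℂ] U n) (w : U n) :
    realizeAct₂ f g (Algebra.TensorProduct.assoc ℂ ℂ ℂ (U n) (U n) (U n) (t ⊗ₜ w)) =
      Weyl.ofCoord n (actMul f g t) * Weyl.heisenberg n w := by
  induction t using TensorProduct.induction_on with
  | zero => simp
  | add s t hs ht => rw [TensorProduct.add_tmul, map_add, map_add, hs, ht, map_add, map_add, add_mul]
  | tmul a b =>
    rw [Algebra.TensorProduct.assoc_tmul, realizeAct₂_tmul, realizeAct_tmul, actMul_tmul, map_mul,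
      mul_assoc]

/-- `F₁₂`. -/
def leg12 (n : ℕ) : U n ⊗[ℂ] U n →ₐ[ℂ] U n ⊗[ℂ] (U n ⊗[ℂ] U n) :=
  (Algebra.TensorProduct.assoc ℂ ℂ ℂ (U n) (U n) (U n)).toAlgHom.comp
    Algebra.TensorProduct.includeLeft

/-- `F₂₃`. -/
def leg23 (n : ℕ) : U n ⊗[ℂ] U n →ₐ[ℂ] U n ⊗[ℂ] (U n ⊗[ℂ] U n) :=
  Algebra.TensorProduct.includeRight

/-- `Δ ⊗ id`. -/
def coproductLeft (n : ℕ) : U n ⊗[ℂ] U n →ₐ[ℂ] U n ⊗[ℂ] (U n ⊗[ℂ] U n) :=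
  (Algebra.TensorProduct.assoc ℂ ℂ ℂ (U n) (U n) (U n)).toAlgHom.comp
    (Algebra.TensorProduct.map (coproduct n) (AlgHom.id ℂ (U n)))

/-- `id ⊗ Δ`. -/
def coproductRight (n : ℕ) : U n ⊗[ℂ] U n →ₐ[ℂ] U n ⊗[ℂ] (U n ⊗[ℂ] U n) :=
  Algebra.TensorProduct.map (AlgHom.id ℂ (U n)) (coproduct n)

/-- The module algebra property turns `Δ(u)` acting on two factors into `u` acting on their product.
With `F⁻¹` in both slots this describes the hat of a star product. -/
theorem realizeAct₂_coproductLeft (f g : Coord n) (s t : U n ⊗[ℂ] U n) :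
    realizeAct₂ f g (coproductLeft n s * leg12 n t) = realizeAct (actMul f g t) s := by
  induction s using TensorProduct.induction_on with
  | zero => simp
  | add s s' hs hs' => rw [map_add, add_mul, map_add, map_add, hs, hs']
  | tmul u v =>
    have : coproductLeft n (u ⊗ₜ v) * leg12 n t =
        Algebra.TensorProduct.assoc ℂ ℂ ℂ (U n) (U n) (U n) ((coproduct n u * t) ⊗ₜ v) := by
      change Algebra.TensorProduct.assoc ℂ ℂ ℂ (U n) (U n) (U n) (coproduct n u ⊗ₜ v) *
        Algebra.TensorProduct.assoc ℂ ℂ ℂ (U n) (U n) (U n) (t ⊗ₜ 1) = _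
      rw [← map_mul, Algebra.TensorProduct.tmul_mul_tmul, mul_one]
    rw [this, realizeAct₂_assoc, realizeAct_tmul, action_actMul]

/-- The cross relation turns `Δ(v)` on the last two legs into left multiplication by `v`. With `F⁻¹`
in both slots this describes a product of two hats. -/
theorem realizeAct₂_coproductRight (f g : Coord n) (s t : U n ⊗[ℂ] U n) :
    realizeAct₂ f g (coproductRight n s * leg23 n t) = realizeAct f s * realizeAct g t := by
  induction s using TensorProduct.induction_on with
  | zero => simp
  | add s s' hs hs' => rw [map_add, add_mul, map_add, map_add, add_mul, hs, hs']
  | tmul u v =>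
    change realizeAct₂ f g ((u ⊗ₜ coproduct n v) * (1 ⊗ₜ t)) = _
    rw [Algebra.TensorProduct.tmul_mul_tmul, mul_one, realizeAct₂_tmul, realizeAct_tmul,
      ← heisenberg_mul_realizeAct, mul_assoc]

theorem realizeAct_add (f g : Coord n) : realizeAct (f + g) = realizeAct f + realizeAct g := by
  rw [realizeAct, actLeft_add, LinearMap.comp_add]; rfl

theorem realizeAct_smul (c : ℂ) (f : Coord n) : realizeAct (c • f) = c • realizeAct f := by
  rw [realizeAct, actLeft_smul, LinearMap.comp_smul]; rfl

/-! ### The hat map and its multiplicativity -/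

/-- The linear map `f ↦ (G¹ ▷ f) G²` in the Heisenberg realization; it is `f ↦ f̂` for `G = F⁻¹`. -/
def hatMap (G : (U n ⊗[ℂ] U n)⟦X⟧) : Coord n →ₗ[ℂ] (Weyl n)⟦X⟧ where
  toFun f := hmap (realizeAct f) G
  map_add' f g := by rw [realizeAct_add, hmap_add]
  map_smul' c f := by rw [realizeAct_smul, hmap_smul]; rfl

theorem hatMap_apply (G : (U n ⊗[ℂ] U n)⟦X⟧) (f : Coord n) :
    hatMap G f = hmap (realizeAct f) G := rfl

theorem realizedHat_eq (F : ((U n ⊗[ℂ] U n)⟦X⟧)ˣ) (f : Coord n) :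
    realizedHat F f = hatMap ↑F⁻¹ f :=
  hmap_hmap _ _ _

/-- The linear map `f ⊗ u ↦ f̂ u` in the Heisenberg realization. -/
def realizeHat (G : (U n ⊗[ℂ] U n)⟦X⟧) : Coord n ⊗[ℂ] U n →ₗ[ℂ] (Weyl n)⟦X⟧ :=
  TensorProduct.lift (LinearMap.mk₂ ℂ
    (fun f u => hatMap G f * PowerSeries.C (Weyl.heisenberg n u))
    (fun f f' u => by rw [map_add, add_mul])
    (fun c f u => by rw [map_smul, smul_mul_assoc])
    (fun f u u' => by rw [map_add, map_add, mul_add])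
    (fun c f u => by rw [map_smul, C_smul, mul_smul_comm]))

theorem realizeHat_tmul (G : (U n ⊗[ℂ] U n)⟦X⟧) (f : Coord n) (u : U n) :
    realizeHat G (f ⊗ₜ u) = hatMap G f * PowerSeries.C (Weyl.heisenberg n u) := rfl

theorem hextend_realizeHat_mulMom (G : (U n ⊗[ℂ] U n)⟦X⟧) (w : U n) (z : (Coord n ⊗[ℂ] U n)⟦X⟧) :
    hextend (realizeHat G) (hmap (mulMom w) z) =
      hextend (realizeHat G) z * PowerSeries.C (Weyl.heisenberg n w) := by
  have : hextendLin (realizeHat G) ∘ₗ hmapLin (mulMom w) =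
      LinearMap.mulRight ℂ⟦X⟧ (PowerSeries.C (Weyl.heisenberg n w)) ∘ₗ
        hextendLin (realizeHat G) := by
    refine hadic_ext_tmul fun f u => ?_
    have e : mulMom w (f ⊗ₜ[ℂ] u) = f ⊗ₜ (u * w) := rfl
    simp only [LinearMap.comp_apply, hextendLin_apply, hmapLin_apply, LinearMap.mulRight_apply,
      hmap_C, hextend_C, e, realizeHat_tmul, map_mul, mul_assoc]
  exact LinearMap.congr_fun this z

theorem hextend_realizeHat_flip (G : (U n ⊗[ℂ] U n)⟦X⟧) (v : U n) (y : (Coord n)⟦X⟧) :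
    hextend (realizeHat G) (hmap ((TensorProduct.mk ℂ (Coord n) (U n)).flip v) y) =
      hextend (hatMap G) y * PowerSeries.C (Weyl.heisenberg n v) := by
  have : hextendLin (realizeHat G) ∘ₗ hmapLin ((TensorProduct.mk ℂ (Coord n) (U n)).flip v) =
      LinearMap.mulRight ℂ⟦X⟧ (PowerSeries.C (Weyl.heisenberg n v)) ∘ₗ hextendLin (hatMap G) := by
    refine hadic_ext fun f => ?_
    simp only [LinearMap.comp_apply, hextendLin_apply, hmapLin_apply, LinearMap.mulRight_apply,
      hmap_C, hextend_C, LinearMap.flip_apply, TensorProduct.mk_apply, realizeHat_tmul]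
  exact LinearMap.congr_fun this y

theorem hmap_realizeAct_mul_C (G : (U n ⊗[ℂ] U n)⟦X⟧) (g : Coord n) (u v : U n) :
    hmap (realizeAct g) (G * PowerSeries.C (u ⊗ₜ v)) =
      hatMap G (action n u g) * PowerSeries.C (Weyl.heisenberg n v) := by
  have : hmapLin (realizeAct g) ∘ₗ LinearMap.mulRight ℂ⟦X⟧ (PowerSeries.C (u ⊗ₜ[ℂ] v)) =
      LinearMap.mulRight ℂ⟦X⟧ (PowerSeries.C (Weyl.heisenberg n v)) ∘ₗ
        hmapLin (realizeAct (action n u g)) := by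
    refine hadic_ext fun t => ?_
    simp only [LinearMap.comp_apply, hmapLin_apply, LinearMap.mulRight_apply, ← map_mul,
      hmap_C, realizeAct_mul_tmul]
  exact LinearMap.congr_fun this G

/-- On `u ⊗ v` the left side is `(G¹ u ▷ g) G² v`. Taking hats thus amounts to multiplying by `G`
from the left, which is what later cancels the `F` in `Δ^F`. -/
theorem hextend_realizeHat_actLeft (G : (U n ⊗[ℂ] U n)⟦X⟧) (g : Coord n)
    (z : (U n ⊗[ℂ] U n)⟦X⟧) :
    hextend (realizeHat G) (hmap (actLeft g) z) = hmap (realizeAct g) (G * z) := by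
  have : hextendLin (realizeHat G) ∘ₗ hmapLin (actLeft g) =
      hmapLin (realizeAct g) ∘ₗ LinearMap.mulLeft ℂ⟦X⟧ G := by
    refine hadic_ext_tmul fun u v => ?_
    have e : actLeft g (u ⊗ₜ[ℂ] v) = action n u g ⊗ₜ v := rfl
    simp only [LinearMap.comp_apply, hextendLin_apply, hmapLin_apply, LinearMap.mulLeft_apply,
      hmap_C, hextend_C, e, realizeHat_tmul, hmap_realizeAct_mul_C]
  exact LinearMap.congr_fun this z

theorem hmap_realizeAct_coproduct_mul (g : Coord n) (u : U n) (z : (U n ⊗[ℂ] U n)⟦X⟧) :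
    hmap (realizeAct g) (PowerSeries.C (coproduct n u) * z) =
      PowerSeries.C (Weyl.heisenberg n u) * hmap (realizeAct g) z := by
  have : hmapLin (realizeAct g) ∘ₗ LinearMap.mulLeft ℂ⟦X⟧ (PowerSeries.C (coproduct n u)) =
      LinearMap.mulLeft ℂ⟦X⟧ (PowerSeries.C (Weyl.heisenberg n u)) ∘ₗ hmapLin (realizeAct g) := by
    refine hadic_ext fun t => ?_
    simp only [LinearMap.comp_apply, hmapLin_apply, LinearMap.mulLeft_apply, ← map_mul,
      hmap_C, heisenberg_mul_realizeAct]
  exact LinearMap.congr_fun this z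

theorem hextend_hatMap_actMul (G H : (U n ⊗[ℂ] U n)⟦X⟧) (f g : Coord n) :
    hextend (hatMap G) (hmap (actMul f g) H) = hmap (realizeAct₂ f g)
      (hmap (coproductLeft n).toLinearMap G * hmap (leg12 n).toLinearMap H) := by
  have : hextendLin (hatMap G) ∘ₗ hmapLin (actMul f g) = hmapLin (realizeAct₂ f g) ∘ₗ
      LinearMap.mulLeft ℂ⟦X⟧ (hmap (coproductLeft n).toLinearMap G) ∘ₗ
        hmapLin (leg12 n).toLinearMap := by
    refine hadic_ext fun t => ?_
    simp only [LinearMap.comp_apply, hextendLin_apply, hmapLin_apply, LinearMap.mulLeft_apply,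
      hmap_C, hextend_C, hatMap_apply]
    have : hmapLin (realizeAct (actMul f g t)) = hmapLin (realizeAct₂ f g) ∘ₗ
        LinearMap.mulRight ℂ⟦X⟧ (PowerSeries.C ((leg12 n).toLinearMap t)) ∘ₗ
          hmapLin (coproductLeft n).toLinearMap := by
      refine hadic_ext fun s => ?_
      simp only [LinearMap.comp_apply, hmapLin_apply, LinearMap.mulRight_apply, hmap_C, ← map_mul,
        AlgHom.toLinearMap_apply, realizeAct₂_coproductLeft]
    exact LinearMap.congr_fun this G
  exact LinearMap.congr_fun this H

theorem hatMap_mul_hatMap (G H : (U n ⊗[ℂ] U n)⟦X⟧) (f g : Coord n) :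
    hatMap G f * hatMap H g = hmap (realizeAct₂ f g)
      (hmap (coproductRight n).toLinearMap G * hmap (leg23 n).toLinearMap H) := by
  have : LinearMap.mulLeft ℂ⟦X⟧ (hatMap G f) ∘ₗ hmapLin (realizeAct g) =
      hmapLin (realizeAct₂ f g) ∘ₗ
        LinearMap.mulLeft ℂ⟦X⟧ (hmap (coproductRight n).toLinearMap G) ∘ₗ
          hmapLin (leg23 n).toLinearMap := by
    refine hadic_ext fun t => ?_
    simp only [LinearMap.comp_apply, hmapLin_apply, LinearMap.mulLeft_apply,
      hmap_C, hatMap_apply]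
    have : LinearMap.mulRight ℂ⟦X⟧ (PowerSeries.C (realizeAct g t)) ∘ₗ hmapLin (realizeAct f) =
        hmapLin (realizeAct₂ f g) ∘ₗ
          LinearMap.mulRight ℂ⟦X⟧ (PowerSeries.C ((leg23 n).toLinearMap t)) ∘ₗ
            hmapLin (coproductRight n).toLinearMap := by
      refine hadic_ext fun s => ?_
      simp only [LinearMap.comp_apply, hmapLin_apply, LinearMap.mulRight_apply, hmap_C, ← map_mul,
        AlgHom.toLinearMap_apply, realizeAct₂_coproductRight]
    exact LinearMap.congr_fun this G
  exact LinearMap.congr_fun this H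

/-- The cocycle condition for `F⁻¹`. -/
theorem IsTwist.cocycle_inv {F : ((U n ⊗[ℂ] U n)⟦X⟧)ˣ} (hF : IsTwist F) :
    hmap (coproductLeft n).toLinearMap ↑F⁻¹ * hmap (leg12 n).toLinearMap ↑F⁻¹ =
      hmap (coproductRight n).toLinearMap ↑F⁻¹ * hmap (leg23 n).toLinearMap ↑F⁻¹ := by
  -- In the group of units, inverting both sides of the cocycle condition reverses the factors and
  -- commutes with the four algebra maps.
  let m (φ : U n ⊗[ℂ] U n →ₐ[ℂ] U n ⊗[ℂ] (U n ⊗[ℂ] U n)) :=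
    Units.map (PowerSeries.map (φ : U n ⊗[ℂ] U n →+* U n ⊗[ℂ] (U n ⊗[ℂ] U n))).toMonoidHom
  have h : m (leg12 n) F * m (coproductLeft n) F = m (leg23 n) F * m (coproductRight n) F :=
    Units.ext hF.cocycle
  have h' := congrArg (fun z => ((z⁻¹ : ((U n ⊗[ℂ] (U n ⊗[ℂ] U n))⟦X⟧)ˣ) :
    (U n ⊗[ℂ] (U n ⊗[ℂ] U n))⟦X⟧)) h
  simp only [mul_inv_rev, ← map_inv, Units.val_mul] at h'
  simp only [hmap_algHom]
  exact h'

/-- The cocycle condition enters here: it identifies the three-leg elements behind the two sides. -/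
theorem IsTwist.hextend_hatMap_starProduct {F : ((U n ⊗[ℂ] U n)⟦X⟧)ˣ} (hF : IsTwist F)
    (f g : Coord n) :
    hextend (hatMap ↑F⁻¹) (starProduct F f g) = hatMap ↑F⁻¹ f * hatMap ↑F⁻¹ g := by
  rw [hatMap_mul_hatMap, ← hF.cocycle_inv, ← hextend_hatMap_actMul]
  -- By definition `f ⋆ g` is `actMul f g` applied to the coefficients of `F⁻¹`.
  rfl

theorem IsTwist.hextend_realizeHat_starLeft {F : ((U n ⊗[ℂ] U n)⟦X⟧)ˣ} (hF : IsTwist F)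
    (f : Coord n) (z : (Coord n ⊗[ℂ] U n)⟦X⟧) :
    hextend (realizeHat ↑F⁻¹) (hextend (starLeft F f) z) =
      hatMap ↑F⁻¹ f * hextend (realizeHat ↑F⁻¹) z := by
  have : hextendLin (realizeHat ↑F⁻¹) ∘ₗ hextendLin (starLeft F f) =
      LinearMap.mulLeft ℂ⟦X⟧ (hatMap ↑F⁻¹ f) ∘ₗ hextendLin (realizeHat ↑F⁻¹) := by
    refine hadic_ext_tmul fun k v => ?_
    have e : starLeft F f (k ⊗ₜ v) =
      hmap ((TensorProduct.mk ℂ (Coord n) (U n)).flip v) (starProduct F f k) := rfl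
    simp only [LinearMap.comp_apply, hextendLin_apply, LinearMap.mulLeft_apply, hextend_C,
      realizeHat_tmul, e, hextend_realizeHat_flip, hF.hextend_hatMap_starProduct, mul_assoc]
  exact LinearMap.congr_fun this z

theorem IsTwist.hextend_realizeHat_smash {F : ((U n ⊗[ℂ] U n)⟦X⟧)ˣ} (hF : IsTwist F)
    (a b : (Coord n ⊗[ℂ] U n)⟦X⟧) :
    hextend (realizeHat ↑F⁻¹) (smash F a b) =
      hextend (realizeHat ↑F⁻¹) a * hextend (realizeHat ↑F⁻¹) b := by
  refine map_hextend₂_eq_mul (smashBilin F) (hextendLin (realizeHat ↑F⁻¹)) (fun a b => ?_) a b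
  simp only [hextendLin_apply, hextend_C]
  induction a using TensorProduct.induction_on with
  | zero => simp
  | add s t hs ht => rw [map_add, LinearMap.add_apply, map_add, map_add, hs, ht, add_mul]
  | tmul f u =>
    induction b using TensorProduct.induction_on with
    | zero => simp
    | add s t hs ht => rw [map_add, map_add, map_add, hs, ht, mul_add]
    | tmul g w =>
      change hextend (realizeHat ↑F⁻¹) (smashPure F f u g w) = _
      -- With this bracketing the `F⁻¹` produced by the hat cancels `F`. What remains, `Δ(u) F⁻¹`,
      -- evaluates to `u ĝ`.
      have e : twistedCoproduct F u = F * (PowerSeries.C (coproduct n u) * ↑F⁻¹) := rfl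
      rw [smashPure, hextend_realizeHat_mulMom, hF.hextend_realizeHat_starLeft,
        hextend_realizeHat_actLeft, e, Units.inv_mul_cancel_left, hmap_realizeAct_coproduct_mul,
        ← hatMap_apply, realizeHat_tmul, realizeHat_tmul]
      simp only [mul_assoc]

/-! ### Normalization, and reduction modulo `h` -/

/-- On the unit polynomial `U` acts through the counit, so the counit normalization of the twist
will give `1̂ = 1`. -/
theorem realizeAct_one (t : U n ⊗[ℂ] U n) :
    realizeAct 1 t = Weyl.heisenberg n ((Algebra.TensorProduct.lid ℂ (U n)).toAlgHom.comp
        (Algebra.TensorProduct.map (counit n) (AlgHom.id ℂ (U n))) t) := by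
  induction t using TensorProduct.induction_on with
  | zero => simp
  | add s t hs ht => rw [map_add, map_add, map_add, hs, ht]
  | tmul u v =>
    rw [realizeAct_tmul, action_one]
    simp

theorem IsTwist.hatMap_one {F : ((U n ⊗[ℂ] U n)⟦X⟧)ˣ} (hF : IsTwist F) :
    hatMap ↑F⁻¹ (1 : Coord n) = 1 := by
  set ε := PowerSeries.map (((Algebra.TensorProduct.lid ℂ (U n)).toAlgHom.comp
        (Algebra.TensorProduct.map (counit n) (AlgHom.id ℂ (U n))) :
          U n ⊗[ℂ] U n →ₐ[ℂ] U n) : U n ⊗[ℂ] U n →+* U n) with hε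
  have h1 : ε ↑F⁻¹ = 1 := by
    have h := hF.counit_left
    rw [← hε] at h
    calc ε ↑F⁻¹ = ε F * ε ↑F⁻¹ := by rw [h, one_mul]
      _ = 1 := by rw [← map_mul, Units.mul_inv, map_one]
  have h2 : hatMap ↑F⁻¹ (1 : Coord n) =
      PowerSeries.map (Weyl.heisenberg n : U n →+* Weyl n) (ε ↑F⁻¹) := by
    ext k
    rw [hatMap_apply, coeff_hmap, realizeAct_one]
    rfl
  rw [h2, h1, map_one]

theorem IsTwist.constantCoeff_inv {F : ((U n ⊗[ℂ] U n)⟦X⟧)ˣ} (hF : IsTwist F) :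
    PowerSeries.constantCoeff (↑F⁻¹ : (U n ⊗[ℂ] U n)⟦X⟧) = 1 := by
  have h := congrArg PowerSeries.constantCoeff (Units.mul_inv F)
  rwa [map_mul, hF.constantCoeff, one_mul, map_one] at h

theorem IsTwist.constantCoeff_hatMap {F : ((U n ⊗[ℂ] U n)⟦X⟧)ˣ} (hF : IsTwist F) (f : Coord n) :
    PowerSeries.constantCoeff (hatMap ↑F⁻¹ f) = Weyl.ofCoord n f := by
  rw [← PowerSeries.coeff_zero_eq_constantCoeff_apply, hatMap_apply, coeff_hmap,
    PowerSeries.coeff_zero_eq_constantCoeff_apply, hF.constantCoeff_inv,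
    Algebra.TensorProduct.one_def, realizeAct_tmul]
  simp

theorem IsTwist.constantCoeff_realizeHat {F : ((U n ⊗[ℂ] U n)⟦X⟧)ˣ} (hF : IsTwist F)
    (t : Coord n ⊗[ℂ] U n) :
    PowerSeries.constantCoeff (realizeHat ↑F⁻¹ t) = Weyl.realize n t := by
  induction t using TensorProduct.induction_on with
  | zero => simp
  | add s t hs ht => rw [map_add, map_add, map_add, hs, ht]
  | tmul f u =>
    rw [realizeHat_tmul, map_mul, hF.constantCoeff_hatMap, PowerSeries.constantCoeff_C]
    rfl

/-! ### Normal ordering in the Weyl algebra -/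

theorem inc_P_mul_inc_P (μ ν : Fin n) :
    inc n (Igl.P μ) * inc n (Igl.P ν) = inc n (Igl.P ν) * inc n (Igl.P μ) := by
  have h := LieHom.map_lie (inc n) (Igl.P μ) (Igl.P ν)
  rw [Igl.lie_P_P, map_zero, LieRing.of_associative_ring_bracket] at h
  exact (sub_eq_zero.1 h.symm)

/-- The surjection from polynomials in the momenta onto `𝔗ⁿ`. -/
def ofMomentum (n : ℕ) : MvPolynomial (Fin n) ℂ →ₐ[ℂ] momenta n :=
  letI : CommRing (momenta n) :=
    { (momenta n).toRing with
      mul_comm := (Algebra.isMulCommutative_adjoin ℂ (by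
        rintro _ ⟨μ, rfl⟩ _ ⟨ν, rfl⟩
        exact inc_P_mul_inc_P μ ν)).is_comm.comm }
  MvPolynomial.aeval fun μ => ⟨inc n (Igl.P μ), Algebra.subset_adjoin ⟨μ, rfl⟩⟩

theorem ofMomentum_X (μ : Fin n) :
    (ofMomentum n (MvPolynomial.X μ) : U n) = inc n (Igl.P μ) := by
  unfold ofMomentum
  simp

theorem ofMomentum_surjective : Function.Surjective (ofMomentum n) := by
  rintro ⟨p, hp⟩
  have h : momenta n ≤ ((momenta n).val.comp (ofMomentum n)).range := by
    refine Algebra.adjoin_le ?_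
    rintro _ ⟨μ, rfl⟩
    exact ⟨MvPolynomial.X μ, ofMomentum_X μ⟩
  obtain ⟨q, hq⟩ := h hp
  exact ⟨q, Subtype.ext hq⟩

namespace Weyl

theorem mem_of_generators_mem (S : Subalgebra ℂ (Weyl n)) (hx : ∀ μ, x μ ∈ S)
    (hP : ∀ μ, P μ ∈ S) (w : Weyl n) : w ∈ S := by
  obtain ⟨a, rfl⟩ := RingQuot.mkAlgHom_surjective ℂ (WeylRel n) w
  change quot n a ∈ S
  induction a using FreeAlgebra.induction with
  | grade0 c => rw [AlgHom.commutes]; exact S.algebraMap_mem c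
  | grade1 g => cases g with
    | x μ => exact hx μ
    | P μ => exact hP μ
  | mul a b ha hb => rw [map_mul]; exact S.mul_mem ha hb
  | add a b ha hb => rw [map_add]; exact S.add_mem ha hb

/-- Normal ordering `f ⊗ q ↦ f(x) q(P)`. -/
def normalOrder (n : ℕ) : Coord n ⊗[ℂ] MvPolynomial (Fin n) ℂ →ₗ[ℂ] Weyl n :=
  realize n ∘ₗ TensorProduct.map LinearMap.id (momenta n).val.toLinearMap ∘ₗ
    TensorProduct.map LinearMap.id (ofMomentum n).toLinearMap

theorem normalOrder_tmul (f : Coord n) (q : MvPolynomial (Fin n) ℂ) :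
    normalOrder n (f ⊗ₜ q) = ofCoord n f * heisenberg n (ofMomentum n q) := rfl

theorem P_mul_ofCoord (μ : Fin n) (f : Coord n) :
    P μ * ofCoord n f = ofCoord n f * P μ + ofCoord n (vectorField (Igl.P μ) f) := by
  rw [← heisenberg_P, heisenberg_inc_mul_ofCoord]

/-- The elements that preserve the normally ordered ones under left multiplication form a
subalgebra. It contains `x^μ` trivially and `P_μ` by the commutation rule, hence everything; apply
this to the normally ordered element `1`. -/
theorem normalOrder_surjective : Function.Surjective (normalOrder n) := by
  let S : Subalgebra ℂ (Weyl n) :=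
    { carrier := {w | ∀ v ∈ LinearMap.range (normalOrder n), w * v ∈ LinearMap.range (normalOrder n)}
      mul_mem' := fun {a b} ha hb v hv => by rw [mul_assoc]; exact ha _ (hb _ hv)
      add_mem' := fun {a b} ha hb v hv => by
        rw [add_mul]; exact Submodule.add_mem _ (ha _ hv) (hb _ hv)
      algebraMap_mem' := fun c v hv => by
        rw [← Algebra.smul_def]; exact Submodule.smul_mem _ c hv }
  intro w
  have hw : w ∈ S := by
    refine mem_of_generators_mem S ?_ ?_ w
    · rintro μ _ ⟨t, rfl⟩
      induction t using TensorProduct.induction_on with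
      | zero => simp
      | add s t hs ht => rw [map_add, mul_add]; exact Submodule.add_mem _ hs ht
      | tmul f q =>
        refine ⟨(MvPolynomial.X μ * f) ⊗ₜ q, ?_⟩
        rw [normalOrder_tmul, normalOrder_tmul, map_mul, ofCoord_X, mul_assoc]
    · rintro μ _ ⟨t, rfl⟩
      induction t using TensorProduct.induction_on with
      | zero => simp
      | add s t hs ht => rw [map_add, mul_add]; exact Submodule.add_mem _ hs ht
      | tmul f q =>
        refine ⟨f ⊗ₜ (MvPolynomial.X μ * q) + vectorField (Igl.P μ) f ⊗ₜ q, ?_⟩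
        rw [map_add, normalOrder_tmul, normalOrder_tmul, normalOrder_tmul, ← mul_assoc,
          P_mul_ofCoord, map_mul, MulMemClass.coe_mul, ofMomentum_X, map_mul, heisenberg_P,
          add_mul, mul_assoc]
  have h1 := hw (normalOrder n (1 ⊗ₜ 1)) ⟨_, rfl⟩
  rwa [normalOrder_tmul, map_one, map_one, one_mul, OneMemClass.coe_one, map_one, mul_one] at h1

/-- The operator by which `x^μ` acts on normally ordered symbols. -/
def symbolX (μ : Fin n) : Module.End ℂ (Coord n ⊗[ℂ] MvPolynomial (Fin n) ℂ) :=
  TensorProduct.map (LinearMap.mulLeft ℂ (MvPolynomial.X μ)) LinearMap.id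

/-- The operator by which `P_μ` acts on normally ordered symbols. -/
def symbolP (μ : Fin n) : Module.End ℂ (Coord n ⊗[ℂ] MvPolynomial (Fin n) ℂ) :=
  TensorProduct.map LinearMap.id (LinearMap.mulLeft ℂ (MvPolynomial.X μ)) +
    TensorProduct.map (vectorField (Igl.P μ) : Coord n →ₗ[ℂ] Coord n) LinearMap.id

theorem symbolX_tmul (μ : Fin n) (f : Coord n) (q : MvPolynomial (Fin n) ℂ) :
    symbolX μ (f ⊗ₜ q) = (MvPolynomial.X μ * f) ⊗ₜ q := rfl

theorem symbolP_tmul (μ : Fin n) (f : Coord n) (q : MvPolynomial (Fin n) ℂ) :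
    symbolP μ (f ⊗ₜ q) = f ⊗ₜ (MvPolynomial.X μ * q) + vectorField (Igl.P μ) f ⊗ₜ q := rfl

theorem vectorField_P_X (μ ν : Fin n) :
    vectorField (Igl.P μ) (MvPolynomial.X ν) =
      MvPolynomial.C (if μ = ν then -Complex.I else 0) := by
  rw [← action_inc, action_P_X]

/-- The commutator of the two fields is the vector field of `[P_μ, P_ν] = 0`. -/
theorem vectorField_P_comm (μ ν : Fin n) (f : Coord n) :
    vectorField (Igl.P μ) (vectorField (Igl.P ν) f) =
      vectorField (Igl.P ν) (vectorField (Igl.P μ) f) := by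
  rw [← sub_eq_zero, ← Derivation.commutator_apply, ← vectorField_lie, Igl.lie_P_P]
  have : vectorField (0 : Igl n) = 0 := by simpa using vectorField_smul 0 (0 : Igl n)
  rw [this, Derivation.zero_apply]

/-- The representation of `𝔚ⁿ` on normally ordered symbols. -/
def symbolRep (n : ℕ) : Weyl n →ₐ[ℂ] Module.End ℂ (Coord n ⊗[ℂ] MvPolynomial (Fin n) ℂ) :=
  RingQuot.liftAlgHom ℂ ⟨FreeAlgebra.lift ℂ fun g => match g with
    | .x μ => symbolX μ
    | .P μ => symbolP μ, by
      intro a b h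
      apply TensorProduct.ext'
      intro f q
      cases h with
      | xx μ ν =>
        simp only [map_mul, FreeAlgebra.lift_ι_apply, Module.End.mul_apply, symbolX_tmul,
          mul_left_comm]
      | PP μ ν =>
        simp only [map_mul, FreeAlgebra.lift_ι_apply, Module.End.mul_apply, symbolP_tmul,
          map_add, mul_left_comm (MvPolynomial.X μ), vectorField_P_comm μ ν]
        abel
      -- The Leibniz rule on `x^ν f` produces the extra term `-i δ`.
      | Px μ ν =>
        simp only [map_mul, map_add, AlgHom.commutes, FreeAlgebra.lift_ι_apply,
          Module.End.mul_apply, LinearMap.add_apply, symbolP_tmul, symbolX_tmul,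
          Module.algebraMap_end_apply, Derivation.leibniz, vectorField_P_X, smul_eq_mul,
          TensorProduct.add_tmul]
        rw [mul_comm f, ← MvPolynomial.smul_eq_C_mul, TensorProduct.smul_tmul']
        abel⟩

theorem symbolRep_x (μ : Fin n) : symbolRep n (x μ) = symbolX μ :=
  (RingQuot.liftAlgHom_mkAlgHom_apply _ _ _ _).trans (FreeAlgebra.lift_ι_apply _ _)

theorem symbolRep_P (μ : Fin n) : symbolRep n (P μ) = symbolP μ :=
  (RingQuot.liftAlgHom_mkAlgHom_apply _ _ _ _).trans (FreeAlgebra.lift_ι_apply _ _)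

theorem symbolRep_ofCoord (f g : Coord n) (q : MvPolynomial (Fin n) ℂ) :
    symbolRep n (ofCoord n f) (g ⊗ₜ q) = (f * g) ⊗ₜ q := by
  induction f using MvPolynomial.induction_on generalizing g with
  | C c =>
    rw [← MvPolynomial.algebraMap_eq, AlgHom.commutes, AlgHom.commutes,
      Module.algebraMap_end_apply, ← Algebra.smul_def, TensorProduct.smul_tmul']
  | add f f' hf hf' => rw [map_add, map_add, LinearMap.add_apply, hf, hf', add_mul,
      TensorProduct.add_tmul]
  | mul_X f μ hf => rw [map_mul, map_mul, Module.End.mul_apply, ofCoord_X, symbolRep_x,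
      symbolX_tmul, hf, mul_assoc]

/-- The derivative part of each momentum operator kills the polynomial `1`, leaving plain
multiplication. -/
theorem symbolRep_ofMomentum (q r : MvPolynomial (Fin n) ℂ) :
    symbolRep n (heisenberg n (ofMomentum n q)) (1 ⊗ₜ r) = 1 ⊗ₜ (q * r) := by
  induction q using MvPolynomial.induction_on generalizing r with
  | C c =>
    rw [← MvPolynomial.algebraMap_eq, AlgHom.commutes, Subalgebra.coe_algebraMap, AlgHom.commutes,
      AlgHom.commutes, Module.algebraMap_end_apply, ← Algebra.smul_def, TensorProduct.tmul_smul]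
  | add q q' hq hq' => rw [map_add, AddMemClass.coe_add, map_add, map_add, LinearMap.add_apply, hq,
      hq', add_mul, TensorProduct.tmul_add]
  | mul_X q μ hq => rw [map_mul, MulMemClass.coe_mul, map_mul, map_mul, Module.End.mul_apply,
      ofMomentum_X, heisenberg_P, symbolRep_P, symbolP_tmul, Derivation.map_one_eq_zero,
      TensorProduct.zero_tmul, add_zero, hq, mul_assoc]

/-- Evaluation at `1 ⊗ 1` is a left inverse of normal ordering, which is therefore injective. -/
theorem symbolRep_normalOrder (t : Coord n ⊗[ℂ] MvPolynomial (Fin n) ℂ) :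
    symbolRep n (normalOrder n t) (1 ⊗ₜ 1) = t := by
  induction t using TensorProduct.induction_on with
  | zero => simp
  | add s t hs ht => rw [map_add, map_add, LinearMap.add_apply, hs, ht]
  | tmul f q => rw [normalOrder_tmul, map_mul, Module.End.mul_apply, symbolRep_ofMomentum,
      symbolRep_ofCoord, mul_one, mul_one]

end Weyl

/-! ### The isomorphism with the Weyl algebra -/

/-- The subspace `𝔛ⁿ ⊗ 𝔗ⁿ` of `𝔛ⁿ ⊗ U(𝔦𝔤𝔩(n))`. -/
def coordMomenta (n : ℕ) : Submodule ℂ (Coord n ⊗[ℂ] U n) :=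
  LinearMap.range (TensorProduct.map (LinearMap.id : Coord n →ₗ[ℂ] Coord n)
    (momenta n).val.toLinearMap)

theorem tmul_mem_coordMomenta (f : Coord n) {p : U n} (hp : p ∈ momenta n) :
    f ⊗ₜ p ∈ coordMomenta n :=
  ⟨f ⊗ₜ ⟨p, hp⟩, rfl⟩

theorem coordMomenta_induction {p : Coord n ⊗[ℂ] U n → Prop} (h0 : p 0)
    (ht : ∀ f, ∀ v ∈ momenta n, p (f ⊗ₜ v)) (ha : ∀ s t, p s → p t → p (s + t))
    {t : Coord n ⊗[ℂ] U n} (h : t ∈ coordMomenta n) : p t := by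
  obtain ⟨s, rfl⟩ := h
  induction s using TensorProduct.induction_on with
  | zero => rwa [map_zero]
  | tmul f v => exact ht f v v.2
  | add s t hs ht => rw [map_add]; exact ha _ _ hs ht

theorem mem_deformedWeyl_iff {a : (Coord n ⊗[ℂ] U n)⟦X⟧} :
    a ∈ deformedWeyl n ↔ ∀ k, PowerSeries.coeff k a ∈ coordMomenta n := Iff.rfl

/-- Lift `t` to a symbol with polynomial momenta. Normal ordering is injective on symbols, so the
lift vanishes and `t` with it; the algebraic independence of the momenta in `U` need not be known
beforehand. -/
theorem realize_eq_zero {t : Coord n ⊗[ℂ] U n} (ht : t ∈ coordMomenta n)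
    (h : Weyl.realize n t = 0) : t = 0 := by
  obtain ⟨s, rfl⟩ := ht
  obtain ⟨r, rfl⟩ := TensorProduct.map_surjective (g := (LinearMap.id : Coord n →ₗ[ℂ] Coord n))
    (g' := (ofMomentum n).toLinearMap) Function.surjective_id ofMomentum_surjective s
  have hr : Weyl.normalOrder n r = 0 := h
  have := Weyl.symbolRep_normalOrder r
  rw [hr, map_zero, LinearMap.zero_apply] at this
  rw [← this, map_zero, map_zero]

theorem exists_realize_eq (w : Weyl n) : ∃ t ∈ coordMomenta n, Weyl.realize n t = w := by
  obtain ⟨t, rfl⟩ := Weyl.normalOrder_surjective w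
  exact ⟨_, ⟨_, rfl⟩, rfl⟩

/-- The isomorphism `f ⊗ p ↦ f̂ p` from the deformed Weyl algebra to `𝔚ⁿ[[h]]`. -/
def IsTwist.weylEquiv {F : ((U n ⊗[ℂ] U n)⟦X⟧)ˣ} (hF : IsTwist F) :
    deformedWeyl n ≃ₗ[ℂ⟦X⟧] (Weyl n)⟦X⟧ :=
  LinearEquiv.ofBijective (hextendLin (realizeHat ↑F⁻¹) ∘ₗ (deformedWeyl n).subtype) (by
    constructor
    · rw [injective_iff_map_eq_zero]
      intro a ha
      refine Subtype.ext (hextend_eq_zero (S := coordMomenta n) _ (fun t ht h => ?_) _ a.2 ha)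
      rw [hF.constantCoeff_realizeHat] at h
      exact realize_eq_zero ht h
    · intro w
      obtain ⟨a, ha, h⟩ := hextend_surjective (S := coordMomenta n) (realizeHat ↑F⁻¹) (fun b => by
        simpa only [hF.constantCoeff_realizeHat] using exists_realize_eq b) w
      exact ⟨⟨a, ha⟩, h⟩)

theorem IsTwist.weylEquiv_tensor {F : ((U n ⊗[ℂ] U n)⟦X⟧)ˣ} (hF : IsTwist F) (f : Coord n)
    (p : momenta n) :
    hF.weylEquiv (tensor f p) = hatMap ↑F⁻¹ f * PowerSeries.C (Weyl.heisenberg n p) :=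
  hextend_C _ _

/-! ### Closure of the deformed Weyl algebra -/

/-- Only the second leg matters. The hypothesis puts the second leg of `Δ^F(p)` in the momenta, the
star product leaves it alone, and right multiplication by `q` stays in the subalgebra. -/
theorem smashPure_mem {F : ((U n ⊗[ℂ] U n)⟦X⟧)ˣ} (hF : MomentaHopf F) (f g : Coord n) {p q : U n}
    (hp : p ∈ momenta n) (hq : q ∈ momenta n) : smashPure F f p g q ∈ deformedWeyl n := by
  have h1 : ∀ k, PowerSeries.coeff k (hmap (actLeft g) (twistedCoproduct F p)) ∈
      coordMomenta n := by
    intro k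
    rw [coeff_hmap]
    obtain ⟨t, ht⟩ := hF p hp k
    rw [← ht]
    clear ht
    induction t using TensorProduct.induction_on with
    | zero => simp
    | add s t hs ht => rw [map_add, map_add]; exact Submodule.add_mem _ hs ht
    | tmul u v => exact tmul_mem_coordMomenta _ v.2
  have h2 : ∀ t ∈ coordMomenta n, ∀ k, PowerSeries.coeff k (starLeft F f t) ∈ coordMomenta n := by
    intro t ht k
    refine coordMomenta_induction (p := fun t => PowerSeries.coeff k (starLeft F f t) ∈ _)
      ?_ ?_ ?_ ht
    · simp
    · intro g v hv
      change PowerSeries.coeff k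
        (hmap ((TensorProduct.mk ℂ (Coord n) (U n)).flip v) (starProduct F f g)) ∈ _
      rw [coeff_hmap]
      exact tmul_mem_coordMomenta _ hv
    · intro s t hs ht
      rw [map_add, map_add]
      exact Submodule.add_mem _ hs ht
  rw [mem_deformedWeyl_iff]
  intro k
  rw [smashPure, coeff_hmap, coeff_hextend]
  refine coordMomenta_induction (p := fun t => mulMom q t ∈ coordMomenta n) ?_ ?_ ?_
    (Submodule.sum_mem _ fun i _ => h2 _ (h1 _) _)
  · simp
  · intro g v hv
    exact tmul_mem_coordMomenta g (mul_mem hv hq)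
  · intro s t hs ht
    rw [map_add]
    exact Submodule.add_mem _ hs ht

theorem smash_mem {F : ((U n ⊗[ℂ] U n)⟦X⟧)ˣ} (hF : MomentaHopf F)
    {a b : (Coord n ⊗[ℂ] U n)⟦X⟧} (ha : a ∈ deformedWeyl n) (hb : b ∈ deformedWeyl n) :
    smash F a b ∈ deformedWeyl n := by
  have h : ∀ s ∈ coordMomenta n, ∀ t ∈ coordMomenta n, smashBilin F s t ∈ deformedWeyl n := by
    intro s hs t ht
    refine coordMomenta_induction (p := fun s => smashBilin F s t ∈ _) ?_ ?_ ?_ hs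
    · rw [map_zero]; exact Submodule.zero_mem _
    · intro f u hu
      refine coordMomenta_induction (p := fun t => smashBilin F (f ⊗ₜ u) t ∈ _) ?_ ?_ ?_ ht
      · rw [map_zero]; exact Submodule.zero_mem _
      · intro g w hw
        exact smashPure_mem hF f g hu hw
      · intro s t hs ht
        rw [map_add]
        exact Submodule.add_mem _ hs ht
    · intro s s' hs hs'
      rw [map_add]
      exact Submodule.add_mem _ hs hs'
  rw [mem_deformedWeyl_iff]
  intro k
  rw [smash, hextend₂_eq_sum]
  refine Submodule.sum_mem _ fun p _ => ?_
  rw [coeff_hextend]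
  exact Submodule.sum_mem _ fun q _ => h _ (ha _) _ (hb _) _

/-! ### Density, and the theorem -/

/-- A `ℂ[[h]]`-subalgebra of `𝔚ⁿ[[h]]` containing lifts of the generators is `h`-adically dense. -/
theorem exists_mem_coeff_eq (S : Subalgebra ℂ⟦X⟧ (Weyl n)⟦X⟧)
    (hx : ∀ μ, ∃ a ∈ S, PowerSeries.constantCoeff a = Weyl.x μ)
    (hP : ∀ μ, ∃ a ∈ S, PowerSeries.constantCoeff a = Weyl.P μ) (w : (Weyl n)⟦X⟧) (k : ℕ) :
    ∃ a ∈ S, ∀ j < k, PowerSeries.coeff j w = PowerSeries.coeff j a := by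
  -- The constant terms of elements of `S` form a subalgebra of the Weyl algebra that contains its
  -- generators.
  have h0 : ∀ v : Weyl n, ∃ a ∈ S, PowerSeries.constantCoeff a = v := by
    refine Weyl.mem_of_generators_mem
      { carrier := {v | ∃ a ∈ S, PowerSeries.constantCoeff a = v}
        mul_mem' := ?_
        add_mem' := ?_
        algebraMap_mem' := ?_ } hx hP
    · rintro _ _ ⟨a, ha, rfl⟩ ⟨b, hb, rfl⟩
      exact ⟨a * b, mul_mem ha hb, map_mul _ _ _⟩
    · rintro _ _ ⟨a, ha, rfl⟩ ⟨b, hb, rfl⟩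
      exact ⟨a + b, add_mem ha hb, map_add _ _ _⟩
    · intro c
      refine ⟨_, S.algebraMap_mem (PowerSeries.C c), ?_⟩
      change PowerSeries.constantCoeff (PowerSeries.map (algebraMap ℂ (Weyl n)) _) = _
      simp
  induction k generalizing w with
  | zero => exact ⟨0, zero_mem _, fun j hj => absurd hj (Nat.not_lt_zero j)⟩
  | succ k ih =>
    -- Match the constant term inside `S`, divide the error by `h`, and approximate the quotient to
    -- order `k`; multiplying back by `h` gains one order.
    obtain ⟨s, hs, hsw⟩ := h0 (PowerSeries.constantCoeff w)
    obtain ⟨v, hv⟩ := PowerSeries.X_dvd_iff.2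
      (show PowerSeries.constantCoeff (w - s) = 0 by rw [map_sub, hsw, sub_self])
    obtain ⟨a, ha, hav⟩ := ih v
    refine ⟨s + (PowerSeries.X ^ 1 : ℂ⟦X⟧) • a, add_mem hs (S.smul_mem ha _), ?_⟩
    rw [eq_add_of_sub_eq' hv, X_pow_smul, pow_one]
    intro j hj
    rw [map_add, map_add]
    congr 1
    cases j with
    | zero => simp
    | succ j =>
      rw [PowerSeries.coeff_succ_X_mul, PowerSeries.coeff_succ_X_mul, hav j (by omega)]

end TwistedWeyl

end

open TwistedWeyl in
theorem proposition3 (n : ℕ) (F : ((U n ⊗[ℂ] U n)⟦X⟧)ˣ) (hF : IsTwist F) :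
    (MomentaHopf F → ∀ a b : deformedWeyl n, smash F a b ∈ deformedWeyl n) ∧
    (∃ e : deformedWeyl n ≃ₗ[ℂ⟦X⟧] (Weyl n)⟦X⟧,
      e (tensor 1 1) = 1 ∧
      (∀ (a b : deformedWeyl n) (hab : smash F a b ∈ deformedWeyl n),
        e ⟨smash F a b, hab⟩ = e a * e b) ∧
      (∀ f : Coord n, e (tensor f 1) = realizedHat F f) ∧
      (∀ p : momenta n, e (tensor 1 p) = PowerSeries.C (Weyl.heisenberg n p))) ∧
    (∀ (w : (Weyl n)⟦X⟧) (k : ℕ),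
      ∃ a ∈ Algebra.adjoin ℂ⟦X⟧
          (Set.range (fun μ : Fin n => realizedHat F (MvPolynomial.X μ)) ∪
            Set.range (fun μ : Fin n => (PowerSeries.C (Weyl.P μ) : (Weyl n)⟦X⟧))),
        ∀ j < k, PowerSeries.coeff j w = PowerSeries.coeff j a) := by
  refine ⟨fun h a b => smash_mem h a.2 b.2, ⟨hF.weylEquiv, ?_, ?_, ?_, ?_⟩, ?_⟩
  · rw [hF.weylEquiv_tensor, hF.hatMap_one, OneMemClass.coe_one, map_one, map_one, mul_one]
  -- The identity holds in the full smash product with `U`, so it restricts to every product that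
  -- lies in the submodule.
  · exact fun a b _ => hF.hextend_realizeHat_smash a b
  · intro f
    rw [hF.weylEquiv_tensor, OneMemClass.coe_one, map_one, map_one, mul_one, realizedHat_eq]
  · intro p
    rw [hF.weylEquiv_tensor, hF.hatMap_one, one_mul]
  · refine exists_mem_coeff_eq _ (fun μ => ?_) (fun μ => ?_)
    · refine ⟨_, Algebra.subset_adjoin (Or.inl ⟨μ, rfl⟩), ?_⟩
      change PowerSeries.constantCoeff (realizedHat F (MvPolynomial.X μ)) = _
      rw [realizedHat_eq, hF.constantCoeff_hatMap, Weyl.ofCoord_X]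
    · exact ⟨_, Algebra.subset_adjoin (Or.inr ⟨μ, rfl⟩), PowerSeries.constantCoeff_C _⟩
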